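/- Let $A+A=\{a+b: a,b\in A\}$, $AA=\{ab: a,b\in A\}$ and $A/A=\{a/b: a,b\in A,\ b\neq 0\}$ for a finite set $A\subset\mathbb{R}$. There are absolute constants $C>0$ and $\kappa>0$ such that every finite set $A\subset\mathbb{R}$ with $|A|\ge 2$ satisfies $$|A|^{\frac43+\frac{5}{9813}}\le C\,\max\{|A+A|,\,|AA|\}\,(\log|A|)^{\kappa}.$$ The same is true with $AA$ replaced by $A/A$: there are absolute constants $C'>0$ and $\kappa'>0$ such that every finite set $A\subset\mathbb{R}$ with $|A|\ge 2$ satisfies $$|A|^{\frac43+\frac{5}{9813}}\le C'\,\max\{|A+A|,\,|A/A|\}\,(\log|A|)^{\kappa'}.$$ -/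

import Mathlib

open scoped Pointwise

/-- The quotient set `A / B = {a / b : a ∈ A, b ∈ B, b ≠ 0}` of two finite sets of reals. -/
noncomputable def quotientSet (A B : Finset ℝ) : Finset ℝ :=
  A / B.erase 0

/-!
For a finite set `A` of `n` positive reals put `H = AA` or `H = A / A` and let `M` bound `|A + A|`
and `|H|`. Solymosi's argument considers the lines through the origin with slopes `i` and the
points of `A × A` on them; the abscissae form the ray `A_i = {x ∈ A : i x ∈ A}`. By Cauchy–Schwarz
`∑ |A_i|² ≥ n⁴ / |H|`, so up to a logarithm this sum lives on a set `S` of slopes with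
`|A_i| ≈ t` (`exists_popular_slopes`). Vector sums from consecutive lines are distinct, whence
`|S| t² ≲ |A + A|²`, and `M ≳ n^(4/3)` follows. The gain beyond `4 / 3` comes from a dichotomy.

* Following Konyagin and Shkredov, the slopes are grouped into clusters of `m ≈ M³ / n⁴` consecutive
  ones, and all pairs of lines in a cluster are used (`clusters_le_card_sumset_sq`). Either this
  improves the bound, or the sums from two different pairs of lines coincide for about `t² / m²`
  points. Projecting along one of the directions turns this into many relations `x + y ∈ Z` with
  `x ∈ A_i` and sets `Y`, `Z` of size about `t` (`exists_relation_of_overlap`). By an argument of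
  Elekes and Ruzsa, `A_i` then has small multiplicative energy (`weighted_energy_le`), so it has at
  least `t² / m⁸` products, up to a logarithm. These lie in `H ∩ i⁻¹ H`. Thus for half of the
  slopes `i ∈ S` the set `H ∩ i⁻¹ H` is nearly as large as `H` (`clusters_of_poor_slopes`).
* A dilate `B` of a large part of `A` consists of such slopes, so every element of `B` is a quotient
  of elements of `H` in many ways. For such a set the third moment of the number of representations
  of differences, and the energy of `B` with any set, are small. An argument of Li compares these
  with the lower bound `|B|⁴ / |B + B|` for the energy and shows that `B + B` is large
  (`card_pow_le_of_quotient_reps`).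

Optimizing gives `n^559 ≲ M^419` up to logarithms (`card_pow_le_sumProduct`), and
`559 / 419 = 4 / 3 + 1 / 1257` exceeds `4 / 3 + 5 / 9813`.

All incidence bounds come from one elementary statement about grids, `sum_card_sq_chains_le`: in a
Cartesian product the Szemerédi–Trotter bound follows by cutting the grid into equal cells, since
an increasing line meets few of them.
-/

/-! ### Incidences in Cartesian products -/

/-- Cutting a finite set of reals into consecutive blocks of `g` elements: `α` is the index of
the block. -/
theorem exists_blocks (P : Finset ℝ) {g : ℕ} (hg : 1 ≤ g) :
    ∃ α : ℝ → ℕ, Monotone α ∧ (∀ u ∈ P, α u * g < P.card) ∧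
      ∀ k, (P.filter (fun u => α u = k)).card ≤ g := by
  classical
  let rk : ℝ → ℕ := fun u => (P.filter (fun v => v < u)).card
  have hmono : Monotone rk := fun u v huv =>
    Finset.card_le_card (Finset.monotone_filter_right _ (fun x _ hx => lt_of_lt_of_le hx huv))
  have hstrict : ∀ u ∈ P, ∀ v, u < v → rk u < rk v := by
    intro u hu v huv
    apply Finset.card_lt_card
    refine (Finset.ssubset_iff_of_subset ?_).2 ⟨u, ?_, ?_⟩
    · exact Finset.monotone_filter_right _ (fun x _ hx => lt_trans hx huv)
    · simp [hu, huv]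
    · simp
  refine ⟨fun u => rk u / g, fun u v huv => Nat.div_le_div_right (hmono huv), ?_, ?_⟩
  · intro u hu
    refine lt_of_le_of_lt (Nat.div_mul_le_self _ _) ?_
    apply Finset.card_lt_card
    refine (Finset.ssubset_iff_of_subset (Finset.filter_subset _ _)).2 ⟨u, hu, by simp⟩
  · intro k
    have : (P.filter (fun u => rk u / g = k)).card ≤ (Finset.Ico (k * g) (k * g + g)).card := by
      apply Finset.card_le_card_of_injOn rk
      · intro u hu
        simp only [Finset.coe_filter, Set.mem_ofPred_eq] at hu
        simp only [Finset.coe_Ico, Set.mem_Ico]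
        have h1 := Nat.div_add_mod (rk u) g
        have h2 := Nat.mod_lt (rk u) hg
        rw [hu.2, mul_comm] at h1
        constructor <;> omega
      · intro u hu v hv huv
        simp only [Finset.coe_filter, Set.mem_ofPred_eq] at hu hv
        rcases lt_trichotomy u v with h | h | h
        · exact absurd huv (hstrict u hu.1 v h).ne
        · exact h
        · exact absurd huv (hstrict v hv.1 u h).ne'
    simpa using this

/-- A second moment form of the Szemerédi–Trotter bound for a Cartesian product `P × Q` and a
family of strictly increasing chains, any two of which share at most one point. Cut the grid into
`r × r` cells; a chain meets at most `2 r - 1` of them, and a pair of points in a common cell lies on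
at most one chain. -/
theorem sum_card_sq_chains_le {ι : Type*} (L : Finset ι) (P Q : Finset ℝ)
    (S : ι → Finset (ℝ × ℝ)) (hS : ∀ l ∈ L, S l ⊆ P ×ˢ Q)
    (hchain : ∀ l ∈ L, ∀ p ∈ S l, ∀ q ∈ S l, p.1 < q.1 ↔ p.2 < q.2)
    (hinter : ∀ l ∈ L, ∀ l' ∈ L, ∀ p ∈ S l, ∀ q ∈ S l, p ∈ S l' → q ∈ S l' → p ≠ q → l = l')
    {r : ℕ} (hr : 1 ≤ r) :
    r * ∑ l ∈ L, (S l).card ^ 2 ≤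
      2 * r ^ 2 * ∑ l ∈ L, (S l).card + 8 * P.card ^ 2 * Q.card ^ 2 := by
  classical
  have key : ∀ l ∈ L, ∀ p ∈ S l, ∀ q ∈ S l, p.1 = q.1 ↔ p.2 = q.2 := by
    intro l hl p hp q hq
    have h1 := hchain l hl p hp q hq
    have h2 := hchain l hl q hq p hp
    constructor
    · intro h
      rw [h] at h1 h2
      simp only [lt_self_iff_false, false_iff] at h1 h2
      exact le_antisymm (not_lt.1 h2) (not_lt.1 h1)
    · intro h
      rw [h] at h1 h2
      simp only [lt_self_iff_false, iff_false] at h1 h2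
      exact le_antisymm (not_lt.1 h2) (not_lt.1 h1)
  have small : (∀ l ∈ L, (S l).card ≤ r) → r * ∑ l ∈ L, (S l).card ^ 2 ≤
      2 * r ^ 2 * ∑ l ∈ L, (S l).card + 8 * P.card ^ 2 * Q.card ^ 2 := by
    intro h
    have : ∑ l ∈ L, (S l).card ^ 2 ≤ r * ∑ l ∈ L, (S l).card := by
      rw [Finset.mul_sum]
      refine Finset.sum_le_sum fun l hl => ?_
      rw [sq]
      exact Nat.mul_le_mul_right _ (h l hl)
    calc r * ∑ l ∈ L, (S l).card ^ 2 ≤ r * (r * ∑ l ∈ L, (S l).card) := Nat.mul_le_mul_left _ this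
      _ = r ^ 2 * ∑ l ∈ L, (S l).card := by ring
      _ ≤ 2 * r ^ 2 * ∑ l ∈ L, (S l).card := by nlinarith [Nat.zero_le (r ^ 2 * ∑ l ∈ L, (S l).card)]
      _ ≤ _ := Nat.le_add_right _ _
  rcases le_or_gt P.card r with hPr | hPr
  · refine small fun l hl => le_trans ?_ hPr
    apply Finset.card_le_card_of_injOn Prod.fst
    · intro p hp
      exact (Finset.mem_product.1 (hS l hl hp)).1
    · intro p hp q hq hpq
      exact Prod.ext hpq ((key l hl p hp q hq).1 hpq)
  rcases le_or_gt Q.card r with hQr | hQr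
  · refine small fun l hl => le_trans ?_ hQr
    apply Finset.card_le_card_of_injOn Prod.snd
    · intro p hp
      exact (Finset.mem_product.1 (hS l hl hp)).2
    · intro p hp q hq hpq
      exact Prod.ext ((key l hl p hp q hq).2 hpq) hpq
  -- block sizes `⌈|P| / r⌉` and `⌈|Q| / r⌉`
  have size : ∀ R : Finset ℝ, r < R.card → ∃ g : ℕ, 1 ≤ g ∧ R.card ≤ r * g ∧ r * g ≤ 2 * R.card := by
    intro R hR
    refine ⟨R.card / r + 1, Nat.le_add_left _ _, ?_, ?_⟩
    · have := Nat.div_add_mod R.card r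
      have := Nat.mod_lt R.card hr
      nlinarith
    · have := Nat.mul_div_le R.card r
      nlinarith
  obtain ⟨g₁, hg₁, hP₁, hP₂⟩ := size P hPr
  obtain ⟨g₂, hg₂, hQ₁, hQ₂⟩ := size Q hQr
  obtain ⟨α, hα, hαr, hαf⟩ := exists_blocks P hg₁
  obtain ⟨β, hβ, hβr, hβf⟩ := exists_blocks Q hg₂
  have hαlt : ∀ u ∈ P, α u < r := fun u hu => by
    have := hαr u hu
    by_contra h
    push Not at h
    nlinarith
  have hβlt : ∀ u ∈ Q, β u < r := fun u hu => by
    have := hβr u hu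
    by_contra h
    push Not at h
    nlinarith
  let cell : ℝ × ℝ → ℕ × ℕ := fun p => (α p.1, β p.2)
  -- on a chain, the cell is determined by the sum of its two indices
  have hcell : ∀ l ∈ L, ∀ p ∈ S l, ∀ q ∈ S l, α p.1 + β p.2 = α q.1 + β q.2 → cell p = cell q := by
    intro l hl p hp q hq h
    rcases lt_trichotomy p.1 q.1 with h1 | h1 | h1
    · have h2 := (hchain l hl p hp q hq).1 h1
      have := hα h1.le
      have := hβ h2.le
      simp only [cell, Prod.mk.injEq]; omega
    · have h2 := (key l hl p hp q hq).1 h1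
      simp [cell, h1, h2]
    · have h2 := (hchain l hl q hq p hp).1 h1
      have := hα h1.le
      have := hβ h2.le
      simp only [cell, Prod.mk.injEq]; omega
  let same : ι → Finset ((ℝ × ℝ) × (ℝ × ℝ)) := fun l =>
    ((S l) ×ˢ (S l)).filter (fun x => cell x.1 = cell x.2)
  have step1 : ∀ l ∈ L, (S l).card ^ 2 ≤ 2 * r * (same l).card := by
    intro l hl
    have hmaps : ∀ p ∈ S l, α p.1 + β p.2 ∈ Finset.range (2 * r) := by
      intro p hp
      have := Finset.mem_product.1 (hS l hl hp)
      have := hαlt _ this.1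
      have := hβlt _ (Finset.mem_product.1 (hS l hl hp)).2
      simp only [Finset.mem_range]; omega
    have e1 := Finset.card_eq_sum_card_fiberwise (f := fun p : ℝ × ℝ => α p.1 + β p.2)
      (s := S l) (t := Finset.range (2 * r)) hmaps
    have e2 : ∑ k ∈ Finset.range (2 * r),
        ((S l).filter (fun p => α p.1 + β p.2 = k)).card ^ 2 ≤ (same l).card := by
      have hmaps' : ∀ x ∈ same l, α x.1.1 + β x.1.2 ∈ Finset.range (2 * r) := by
        intro x hx
        exact hmaps _ (Finset.mem_product.1 (Finset.mem_filter.1 hx).1).1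
      rw [Finset.card_eq_sum_card_fiberwise hmaps']
      refine Finset.sum_le_sum fun k _ => ?_
      rw [sq, ← Finset.card_product]
      refine Finset.card_le_card fun x hx => ?_
      simp only [Finset.mem_product, Finset.mem_filter] at hx
      simp only [same, Finset.mem_filter, Finset.mem_product]
      exact ⟨⟨⟨hx.1.1, hx.2.1⟩, hcell l hl _ hx.1.1 _ hx.2.1 (hx.1.2.trans hx.2.2.symm)⟩, hx.1.2⟩
    rw [e1]
    refine (sq_sum_le_card_mul_sum_sq).trans ?_
    rw [Finset.card_range]
    exact Nat.mul_le_mul_left _ e2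
  have step2 : ∑ l ∈ L, (same l).card ≤ ∑ l ∈ L, (S l).card + P.card * Q.card * (g₁ * g₂) := by
    let off : ι → Finset ((ℝ × ℝ) × (ℝ × ℝ)) := fun l => (same l).filter (fun x => x.1 ≠ x.2)
    have h1 : ∀ l ∈ L, (same l).card ≤ (S l).card + (off l).card := by
      intro l _
      rw [← Finset.card_filter_add_card_filter_not (s := same l) (fun x => x.1 = x.2)]
      refine Nat.add_le_add ?_ le_rfl
      apply Finset.card_le_card_of_injOn Prod.fst
      · intro x hx
        simp only [same, Finset.coe_filter, Finset.mem_filter, Finset.mem_product,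
          Set.mem_ofPred_eq] at hx
        exact hx.1.1.1
      · intro x hx y hy hxy
        simp only [Finset.coe_filter, Set.mem_ofPred_eq] at hx hy
        exact Prod.ext hxy (by rw [← hx.2, ← hy.2, hxy])
    refine (Finset.sum_le_sum h1).trans ?_
    rw [Finset.sum_add_distrib]
    refine Nat.add_le_add_left ?_ _
    have hdisj : (L : Set ι).PairwiseDisjoint off := by
      intro l hl l' hl' hne
      rw [Function.onFun, Finset.disjoint_left]
      intro x hx hx'
      simp only [off, same, Finset.mem_filter, Finset.mem_product] at hx hx'
      exact hne (hinter l hl l' hl' _ hx.1.1.1 _ hx.1.1.2 hx'.1.1.1 hx'.1.1.2 hx.2)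
    rw [← Finset.card_biUnion hdisj]
    have hsub : L.biUnion off ⊆ (P ×ˢ Q).biUnion (fun p =>
        ((P.filter (fun u => α u = α p.1)) ×ˢ (Q.filter (fun v => β v = β p.2))).image
          (fun q => (p, q))) := by
      intro x hx
      simp only [off, same, Finset.mem_biUnion, Finset.mem_filter, Finset.mem_product] at hx
      obtain ⟨l, hl, ⟨⟨hx1, hx2⟩, hc⟩, -⟩ := hx
      simp only [cell, Prod.mk.injEq] at hc
      have m1 := Finset.mem_product.1 (hS l hl hx1)
      have m2 := Finset.mem_product.1 (hS l hl hx2)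
      refine Finset.mem_biUnion.2 ⟨x.1, hS l hl hx1, Finset.mem_image.2 ⟨x.2, ?_, rfl⟩⟩
      simp only [Finset.mem_product, Finset.mem_filter]
      exact ⟨⟨m2.1, hc.1.symm⟩, ⟨m2.2, hc.2.symm⟩⟩
    refine (Finset.card_le_card hsub).trans ?_
    refine (Finset.card_biUnion_le_card_mul _ _ (g₁ * g₂) fun p _ => ?_).trans ?_
    · refine Finset.card_image_le.trans ?_
      rw [Finset.card_product]
      exact Nat.mul_le_mul (hαf _) (hβf _)
    · rw [Finset.card_product]
  calc r * ∑ l ∈ L, (S l).card ^ 2 ≤ r * ∑ l ∈ L, 2 * r * (same l).card :=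
        Nat.mul_le_mul_left _ (Finset.sum_le_sum step1)
    _ = 2 * r ^ 2 * ∑ l ∈ L, (same l).card := by rw [← Finset.mul_sum]; ring
    _ ≤ 2 * r ^ 2 * (∑ l ∈ L, (S l).card + P.card * Q.card * (g₁ * g₂)) :=
        Nat.mul_le_mul_left _ step2
    _ = 2 * r ^ 2 * ∑ l ∈ L, (S l).card + 2 * P.card * Q.card * ((r * g₁) * (r * g₂)) := by ring
    _ ≤ 2 * r ^ 2 * ∑ l ∈ L, (S l).card + 2 * P.card * Q.card * ((2 * P.card) * (2 * Q.card)) := by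
        gcongr
    _ = _ := by ring

/-! ### Few products, many sums -/

/-- The number of representations of `z` as a difference `b - c` with `b ∈ B` and `c ∈ C`. -/
noncomputable def diffRep (B C : Finset ℝ) (z : ℝ) : ℕ :=
  ((B ×ˢ C).filter (fun p => p.1 - p.2 = z)).card

/-- The sum of squared fibre sizes counts the pairs of elements with the same image. -/
theorem sum_card_fiber_sq {α β : Type*} [DecidableEq β] (T : Finset α)
    (K : Finset β) (f : α → β) (hf : ∀ t ∈ T, f t ∈ K) :
    ∑ k ∈ K, (T.filter (fun t => f t = k)).card ^ 2 =
      ((T ×ˢ T).filter (fun x => f x.1 = f x.2)).card := by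
  classical
  have hm : ∀ x ∈ (T ×ˢ T).filter (fun x => f x.1 = f x.2), f x.1 ∈ K := fun x hx =>
    hf _ (Finset.mem_product.1 (Finset.mem_filter.1 hx).1).1
  rw [Finset.card_eq_sum_card_fiberwise hm]
  refine Finset.sum_congr rfl fun k _ => ?_
  rw [sq, ← Finset.card_product]
  congr 1
  ext x
  simp only [Finset.mem_product, Finset.mem_filter]
  constructor
  · rintro ⟨⟨h1, h2⟩, h3, h4⟩
    exact ⟨⟨⟨h1, h3⟩, h2.trans h4.symm⟩, h2⟩
  · rintro ⟨⟨⟨h1, h3⟩, h⟩, h2⟩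
    exact ⟨⟨h1, h2⟩, h3, h.symm.trans h2⟩

theorem sum_diffRep (B C : Finset ℝ) :
    ∑ z ∈ B - C, diffRep B C z = B.card * C.card := by
  classical
  rw [← Finset.card_product]
  refine (Finset.card_eq_sum_card_fiberwise fun p hp => ?_).symm
  have := Finset.mem_product.1 hp
  exact Finset.sub_mem_sub this.1 this.2

theorem diffRep_le (B C : Finset ℝ) (z : ℝ) : diffRep B C z ≤ B.card := by
  apply Finset.card_le_card_of_injOn Prod.fst
  · intro p hp
    exact (Finset.mem_product.1 (Finset.mem_filter.1 hp).1).1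
  · intro p hp q hq h
    have h1 := (Finset.mem_filter.1 hp).2
    have h2 := (Finset.mem_filter.1 hq).2
    refine Prod.ext h ?_
    rw [h] at h1
    linarith

theorem diffRep_pos {B C : Finset ℝ} {z : ℝ} (hz : z ∈ B - C) : 1 ≤ diffRep B C z := by
  obtain ⟨b, hb, c, hc, rfl⟩ := Finset.mem_sub.1 hz
  exact Finset.card_pos.2 ⟨(b, c), by simp [hb, hc]⟩

/-- If every `a ∈ B` has at least `h` representations `a = p / q` with `p, q ∈ H`, then differences
`a - c = z` become incidences of the points `(p, c)` with the lines `p / q - c = z`, indexed by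
`(q, z)`, and the incidence bound controls the second moment of `diffRep B C` over any set. -/
theorem sum_diffRep_sq_le (B C H Z : Finset ℝ) (hH : ∀ q ∈ H, 0 < q) {h : ℕ}
    (hB : ∀ a ∈ B, h ≤ (H.filter (fun q => a * q ∈ H)).card) {r : ℕ} (hr : 1 ≤ r) :
    h ^ 2 * (r * ∑ z ∈ Z, diffRep B C z ^ 2) ≤
      H.card * (2 * r ^ 2 * (h * ∑ z ∈ Z, diffRep B C z) + 8 * H.card ^ 2 * C.card ^ 2) := by
  classical
  -- exactly `h` denominators `q` are kept for each `a`, which bounds the number of incidences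
  have hT : ∀ a : ℝ, ∃ T : Finset ℝ, a ∈ B →
      T ⊆ H.filter (fun q => a * q ∈ H) ∧ T.card = h := by
    intro a
    by_cases ha : a ∈ B
    · obtain ⟨T, h1, h2⟩ := Finset.exists_subset_card_eq (hB a ha)
      exact ⟨T, fun _ => ⟨h1, h2⟩⟩
    · exact ⟨∅, fun h => absurd h ha⟩
  choose T hT using hT
  let S : ℝ × ℝ → Finset (ℝ × ℝ) := fun l => (H ×ˢ C).filter
    (fun p => p.1 / l.1 ∈ B ∧ l.1 ∈ T (p.1 / l.1) ∧ p.1 / l.1 - p.2 = l.2)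
  have hcount : ∀ z, ∑ q ∈ H, (S (q, z)).card = h * diffRep B C z := by
    intro z
    let F := (B ×ˢ C).filter (fun p => p.1 - p.2 = z)
    have h1 : ∀ q ∈ H, (S (q, z)).card = (F.filter (fun x => q ∈ T x.1)).card := by
      intro q hq
      have hq0 := (hH q hq).ne'
      refine Finset.card_bij' (fun p _ => (p.1 / q, p.2)) (fun x _ => (x.1 * q, x.2)) ?_ ?_ ?_ ?_
      · intro p hp
        simp only [S, F, Finset.mem_filter, Finset.mem_product] at hp ⊢
        exact ⟨⟨⟨hp.2.1, hp.1.2⟩, hp.2.2.2⟩, hp.2.2.1⟩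
      · intro x hx
        simp only [S, F, Finset.mem_filter, Finset.mem_product] at hx ⊢
        have h3 := Finset.mem_filter.1 ((hT x.1 hx.1.1.1).1 hx.2)
        rw [mul_div_cancel_right₀ _ hq0]
        exact ⟨⟨h3.2, hx.1.1.2⟩, hx.1.1.1, hx.2, hx.1.2⟩
      · intro p _
        simp [div_mul_cancel₀ _ hq0]
      · intro x _
        simp [mul_div_cancel_right₀ _ hq0]
    rw [Finset.sum_congr rfl h1]
    have h2 := Finset.sum_card_bipartiteAbove_eq_sum_card_bipartiteBelow
      (s := H) (t := F) (fun q x => q ∈ T x.1)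
    simp only [Finset.bipartiteAbove, Finset.bipartiteBelow] at h2
    rw [h2]
    have h3 : ∀ x ∈ F, (H.filter (fun q => q ∈ T x.1)).card = h := by
      intro x hx
      simp only [F, Finset.mem_filter, Finset.mem_product] at hx
      obtain ⟨h4, h5⟩ := hT x.1 hx.1.1
      rw [← h5]
      congr 1
      ext q
      simp only [Finset.mem_filter]
      exact ⟨fun h => h.2, fun h => ⟨(Finset.mem_filter.1 (h4 h)).1, h⟩⟩
    rw [Finset.sum_congr rfl h3, Finset.sum_const, smul_eq_mul, mul_comm]
    rfl
  have hinc := sum_card_sq_chains_le (H ×ˢ Z) H C S (fun l _ => Finset.filter_subset _ _)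
    (by
      rintro ⟨q, z⟩ hl p hp p' hp'
      simp only [S, Finset.mem_filter, Finset.mem_product] at hl hp hp'
      have hq := hH q hl.1
      rw [← div_lt_div_iff_of_pos_right hq]
      have := hp.2.2.2
      have := hp'.2.2.2
      constructor <;> intro h <;> linarith)
    (by
      rintro ⟨q, z⟩ hl ⟨q', z'⟩ hl' p hp p' hp' hp2 hp2' hne
      simp only [S, Finset.mem_filter, Finset.mem_product] at hl hl' hp hp' hp2 hp2'
      have hq := hH q hl.1
      have hq' := hH q' hl'.1
      have e1 := hp.2.2.2
      have e2 := hp'.2.2.2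
      have e3 := hp2.2.2.2
      have e4 := hp2'.2.2.2
      have hne1 : p.1 - p'.1 ≠ 0 := by
        intro h0
        apply hne
        have h1 : p.1 = p'.1 := by linarith
        refine Prod.ext h1 ?_
        rw [h1] at e1
        linarith
      have e5 : (p.1 - p'.1) / q = (p.1 - p'.1) / q' := by
        rw [sub_div, sub_div]; linarith
      have e6 : q = q' := by
        rw [div_eq_div_iff hq.ne' hq'.ne'] at e5
        exact (mul_left_cancel₀ hne1 e5).symm
      subst e6
      rw [Prod.mk.injEq]
      exact ⟨rfl, e1.symm.trans e3⟩) hr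
  rw [Finset.sum_product_right, Finset.sum_product_right] at hinc
  have e1 : ∀ z ∈ Z, h ^ 2 * diffRep B C z ^ 2 ≤ H.card * ∑ q ∈ H, (S (q, z)).card ^ 2 := by
    intro z _
    rw [← mul_pow, ← hcount z]
    exact sq_sum_le_card_mul_sum_sq
  have e2 := Finset.sum_le_sum e1
  rw [← Finset.mul_sum, ← Finset.mul_sum] at e2
  have e3 : ∑ z ∈ Z, ∑ q ∈ H, (S (q, z)).card = h * ∑ z ∈ Z, diffRep B C z := by
    rw [Finset.mul_sum]
    exact Finset.sum_congr rfl fun z _ => hcount z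
  rw [e3] at hinc
  calc h ^ 2 * (r * ∑ z ∈ Z, diffRep B C z ^ 2)
      = r * (h ^ 2 * ∑ z ∈ Z, diffRep B C z ^ 2) := by ring
    _ ≤ r * (H.card * ∑ z ∈ Z, ∑ q ∈ H, (S (q, z)).card ^ 2) := Nat.mul_le_mul_left _ e2
    _ = H.card * (r * ∑ z ∈ Z, ∑ q ∈ H, (S (q, z)).card ^ 2) := by ring
    _ ≤ _ := Nat.mul_le_mul_left _ hinc

/-- Optimizing the number of cells in `sum_diffRep_sq_le`: a bound for the additive energy of `B`
and `C`. -/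
theorem energy_sq_le (B C H : Finset ℝ) (hH : ∀ q ∈ H, 0 < q) {h : ℕ} (hh : 1 ≤ h)
    (hB : ∀ a ∈ B, h ≤ (H.filter (fun q => a * q ∈ H)).card)
    (hBH : B.card ≤ H.card) :
    (h : ℝ) ^ 3 * (∑ z ∈ B - C, (diffRep B C z : ℝ) ^ 2) ^ 2 ≤
      256 * (H.card : ℝ) ^ 4 * B.card * (C.card : ℝ) ^ 3 := by
  classical
  rcases B.eq_empty_or_nonempty with rfl | hBne
  · simp
  rcases C.eq_empty_or_nonempty with rfl | hCne
  · simp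
  obtain ⟨a, ha⟩ := hBne
  have hhH : h ≤ H.card := (hB a ha).trans (Finset.card_filter_le _ _)
  have hN : (1 : ℝ) ≤ B.card := by exact_mod_cast Finset.card_pos.2 ⟨a, ha⟩
  have hc : (1 : ℝ) ≤ C.card := by exact_mod_cast hCne.card_pos
  have hh' : (1 : ℝ) ≤ h := by exact_mod_cast hh
  have hhH' : (h : ℝ) ≤ H.card := by exact_mod_cast hhH
  have hBH' : (B.card : ℝ) ≤ H.card := by exact_mod_cast hBH
  have main := fun (r : ℕ) (hr : 1 ≤ r) => sum_diffRep_sq_le B C H (B - C) hH hB hr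
  simp only [sum_diffRep] at main
  set N : ℝ := (B.card : ℝ)
  set c : ℝ := (C.card : ℝ)
  set η : ℝ := (H.card : ℝ)
  set E : ℝ := ∑ z ∈ B - C, (diffRep B C z : ℝ) ^ 2 with hE
  have hE0 : 0 ≤ E := Finset.sum_nonneg fun _ _ => sq_nonneg _
  have hη : 1 ≤ η := hh'.trans hhH'
  -- the number of cells that balances the two terms of the bound
  set ρ : ℝ := √(η ^ 2 * c / (h * N)) with hρ
  have hpos : (0 : ℝ) < h * N := by positivity
  have hρ2 : ρ ^ 2 * (h * N) = η ^ 2 * c := by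
    rw [hρ, Real.sq_sqrt (by positivity), div_mul_cancel₀ _ hpos.ne']
  have hρ1 : 1 ≤ ρ := by
    rw [hρ, Real.one_le_sqrt, le_div_iff₀ hpos, one_mul]
    calc h * N ≤ η * η := by gcongr
      _ = η ^ 2 * 1 := by ring
      _ ≤ η ^ 2 * c := by gcongr
  have hr1 : 1 ≤ ⌈ρ⌉₊ := Nat.one_le_ceil_iff.2 (by linarith)
  have hr2 : ρ ≤ ⌈ρ⌉₊ := Nat.le_ceil ρ
  have hr3 : (⌈ρ⌉₊ : ℝ) ≤ 2 * ρ := by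
    have := Nat.ceil_lt_add_one (a := ρ) (by linarith)
    linarith
  have key : (h : ℝ) ^ 2 * (⌈ρ⌉₊ * E) ≤
      η * (2 * (⌈ρ⌉₊ : ℝ) ^ 2 * (h * (N * c)) + 8 * η ^ 2 * c ^ 2) := by
    have h0 := (Nat.cast_le (α := ℝ)).2 (main ⌈ρ⌉₊ hr1)
    push_cast at h0
    exact h0
  have key2 : (h : ℝ) ^ 2 * (ρ * E) ≤ 16 * η ^ 3 * c ^ 2 := by
    calc (h : ℝ) ^ 2 * (ρ * E) ≤ (h : ℝ) ^ 2 * (⌈ρ⌉₊ * E) := by gcongr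
      _ ≤ _ := key
      _ ≤ η * (2 * (2 * ρ) ^ 2 * (h * (N * c)) + 8 * η ^ 2 * c ^ 2) := by gcongr
      _ = η * (8 * c * (ρ ^ 2 * (h * N)) + 8 * η ^ 2 * c ^ 2) := by ring
      _ = 16 * η ^ 3 * c ^ 2 := by rw [hρ2]; ring
  have key3 : ((h : ℝ) ^ 2 * (ρ * E)) ^ 2 ≤ (16 * η ^ 3 * c ^ 2) ^ 2 := by gcongr
  have hpos2 : (0 : ℝ) < h * η ^ 2 * c := by positivity
  refine le_of_mul_le_mul_left ?_ hpos2
  calc h * η ^ 2 * c * ((h : ℝ) ^ 3 * E ^ 2) = (h : ℝ) ^ 4 * E ^ 2 * (η ^ 2 * c) := by ring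
    _ = ((h : ℝ) ^ 2 * (ρ * E)) ^ 2 * (h * N) := by rw [← hρ2]; ring
    _ ≤ (16 * η ^ 3 * c ^ 2) ^ 2 * (h * N) := by gcongr
    _ = _ := by ring

/-- The contribution of one dyadic range to the third moment of `diffRep B B`. -/
theorem sum_diffRep_cube_dyadic_le (B H Z : Finset ℝ) (hH : ∀ q ∈ H, 0 < q) {h : ℕ} (hh : 1 ≤ h)
    (hB : ∀ a ∈ B, h ≤ (H.filter (fun q => a * q ∈ H)).card) (hZ : Z ⊆ B - B) {t : ℕ}
    (ht : ∀ z ∈ Z, t ≤ diffRep B B z ∧ diffRep B B z ≤ 2 * t) :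
    h ^ 3 * ∑ z ∈ Z, diffRep B B z ^ 3 ≤ 256 * H.card ^ 4 * B.card ^ 2 := by
  classical
  rcases Z.eq_empty_or_nonempty with rfl | ⟨z₀, hz₀⟩
  · simp
  obtain ⟨a, ha, -⟩ := Finset.mem_sub.1 (hZ hz₀)
  have hhH : h ≤ H.card := (hB a ha).trans (Finset.card_filter_le _ _)
  have ht1 : 1 ≤ 2 * t := (diffRep_pos (hZ hz₀)).trans (ht z₀ hz₀).2
  have htot : ∑ z ∈ Z, diffRep B B z ≤ B.card ^ 2 := by
    refine (Finset.sum_le_sum_of_subset hZ).trans ?_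
    rw [sum_diffRep, sq]
  set σ := ∑ z ∈ Z, diffRep B B z ^ 2 with hσ
  have h3 : ∑ z ∈ Z, diffRep B B z ^ 3 ≤ 2 * t * σ := by
    rw [hσ, Finset.mul_sum]
    refine Finset.sum_le_sum fun z hz => ?_
    rw [pow_succ']
    exact Nat.mul_le_mul_right _ (ht z hz).2
  have h1 : t * ∑ z ∈ Z, diffRep B B z ≤ σ := by
    rw [hσ, Finset.mul_sum]
    refine Finset.sum_le_sum fun z hz => ?_
    rw [sq]
    exact Nat.mul_le_mul_right _ (ht z hz).1
  have h2 : σ ≤ 2 * t * ∑ z ∈ Z, diffRep B B z := by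
    rw [hσ, Finset.mul_sum]
    refine Finset.sum_le_sum fun z hz => ?_
    rw [sq]
    exact Nat.mul_le_mul_right _ (ht z hz).2
  set η := H.card
  have hη : 1 ≤ η := hh.trans hhH
  rcases le_or_gt (4 * η) (h * t) with hc | hc
  · -- the number of cells is chosen so that the linear term is absorbed
    set r := h * t / (4 * η) with hr
    have hr1 : 1 ≤ r := (Nat.one_le_div_iff (by omega)).2 hc
    have hr2 : r * (4 * η) ≤ h * t := Nat.div_mul_le_self _ _
    have hr3 : h * t ≤ 8 * (r * η) := by
      have e1 := Nat.div_add_mod (h * t) (4 * η)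
      have e2 := Nat.mod_lt (h * t) (show 0 < 4 * η by omega)
      rw [← hr] at e1
      nlinarith
    have key := sum_diffRep_sq_le B B H Z hH hB hr1
    have k1 : h ^ 2 * (r * σ) ≤ 16 * η ^ 3 * B.card ^ 2 := by
      refine Nat.le_of_mul_le_mul_right ?_ (show 0 < t by omega)
      have e1 : η * (2 * r ^ 2 * (h * (t * ∑ z ∈ Z, diffRep B B z))) * 2 ≤
          h ^ 2 * (r * σ) * t := by
        calc η * (2 * r ^ 2 * (h * (t * ∑ z ∈ Z, diffRep B B z))) * 2
            ≤ η * (2 * r ^ 2 * (h * σ)) * 2 := by gcongr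
          _ = (r * (4 * η)) * (r * (h * σ)) := by ring
          _ ≤ (h * t) * (r * (h * σ)) := by gcongr
          _ = _ := by ring
      have e2 : h ^ 2 * (r * σ) * t ≤ η * (2 * r ^ 2 * (h * ∑ z ∈ Z, diffRep B B z) +
          8 * η ^ 2 * B.card ^ 2) * t := Nat.mul_le_mul_right t key
      have e3 : η * (2 * r ^ 2 * (h * ∑ z ∈ Z, diffRep B B z) + 8 * η ^ 2 * B.card ^ 2) * t =
          η * (2 * r ^ 2 * (h * (t * ∑ z ∈ Z, diffRep B B z))) + 8 * η ^ 3 * B.card ^ 2 * t := by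
        ring
      linarith
    calc h ^ 3 * ∑ z ∈ Z, diffRep B B z ^ 3 ≤ h ^ 3 * (2 * t * σ) := by gcongr
      _ = 2 * h ^ 2 * (h * t) * σ := by ring
      _ ≤ 2 * h ^ 2 * (8 * (r * η)) * σ := by gcongr
      _ = 16 * η * (h ^ 2 * (r * σ)) := by ring
      _ ≤ 16 * η * (16 * η ^ 3 * B.card ^ 2) := by gcongr
      _ = _ := by ring
  -- the range `h t < 4 |H|` is small enough for the trivial bound `∑ diffRep B B z ≤ |B|²`
  · calc h ^ 3 * ∑ z ∈ Z, diffRep B B z ^ 3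
        ≤ h ^ 3 * (2 * t * (2 * t * B.card ^ 2)) := by
          gcongr
          refine h3.trans (Nat.mul_le_mul_left _ (h2.trans ?_))
          gcongr
      _ = h * (h * t) ^ 2 * 4 * B.card ^ 2 := by ring
      _ ≤ η * (4 * η) ^ 2 * 4 * B.card ^ 2 := by gcongr
      _ = 64 * η ^ 3 * 1 * B.card ^ 2 := by ring
      _ ≤ 256 * η ^ 3 * η * B.card ^ 2 := by gcongr; norm_num
      _ = _ := by ring

/-- The third moment of `diffRep B B`, with one logarithm lost in the dyadic decomposition. -/
theorem sum_diffRep_cube_le (B H : Finset ℝ) (hH : ∀ q ∈ H, 0 < q) {h : ℕ} (hh : 1 ≤ h)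
    (hB : ∀ a ∈ B, h ≤ (H.filter (fun q => a * q ∈ H)).card) {n : ℕ} (hn : B.card ≤ n) :
    h ^ 3 * ∑ z ∈ B - B, diffRep B B z ^ 3 ≤
      256 * (Nat.log 2 n + 1) * H.card ^ 4 * B.card ^ 2 := by
  classical
  have hm : ∀ z ∈ B - B, Nat.log 2 (diffRep B B z) ∈ Finset.range (Nat.log 2 n + 1) := by
    intro z _
    exact Finset.mem_range.2 (Nat.lt_succ_of_le (Nat.log_mono_right ((diffRep_le B B z).trans hn)))
  rw [← Finset.sum_fiberwise_of_maps_to hm, Finset.mul_sum]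
  have : ∀ j ∈ Finset.range (Nat.log 2 n + 1),
      h ^ 3 * ∑ z ∈ (B - B).filter (fun z => Nat.log 2 (diffRep B B z) = j), diffRep B B z ^ 3 ≤
        256 * H.card ^ 4 * B.card ^ 2 := by
    intro j _
    refine sum_diffRep_cube_dyadic_le B H _ hH hh hB (Finset.filter_subset _ _) (t := 2 ^ j) ?_
    intro z hz
    rw [Finset.mem_filter] at hz
    have h1 := diffRep_pos hz.1
    have h2 := Nat.pow_log_le_self 2 (x := diffRep B B z) (by omega)
    have h3 := Nat.lt_pow_succ_log_self (b := 2) (by norm_num) (diffRep B B z)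
    rw [hz.2] at h2 h3
    rw [pow_succ'] at h3
    exact ⟨h2, h3.le⟩
  refine (Finset.sum_le_sum this).trans (le_of_eq ?_)
  rw [Finset.sum_const, Finset.card_range, smul_eq_mul]
  ring

/-- The energy of a set is controlled from below by its sumset. -/
theorem card_pow_four_le_energy (B : Finset ℝ) :
    B.card ^ 4 ≤ (B + B).card * ∑ z ∈ B - B, diffRep B B z ^ 2 := by
  classical
  have hm : ∀ p ∈ B ×ˢ B, p.1 + p.2 ∈ B + B := fun p hp =>
    Finset.add_mem_add (Finset.mem_product.1 hp).1 (Finset.mem_product.1 hp).2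
  have h1 := Finset.card_eq_sum_card_fiberwise (f := fun p : ℝ × ℝ => p.1 + p.2) hm
  rw [Finset.card_product] at h1
  have h2 : B.card ^ 4 = (B.card * B.card) ^ 2 := by ring
  rw [h2, h1]
  refine sq_sum_le_card_mul_sum_sq.trans (Nat.mul_le_mul_left _ ?_)
  rw [sum_card_fiber_sq _ _ _ hm]
  have hm2 : ∀ x ∈ ((B ×ˢ B) ×ˢ (B ×ˢ B)).filter (fun x => x.1.1 + x.1.2 = x.2.1 + x.2.2),
      x.1.1 - x.2.1 ∈ B - B := fun x hx => by
    simp only [Finset.mem_filter, Finset.mem_product] at hx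
    exact Finset.sub_mem_sub hx.1.1.1 hx.1.2.1
  rw [Finset.card_eq_sum_card_fiberwise hm2]
  refine Finset.sum_le_sum fun z _ => ?_
  rw [sq, diffRep, ← Finset.card_product]
  apply Finset.card_le_card_of_injOn (fun x => ((x.1.1, x.2.1), (x.2.2, x.1.2)))
  · intro x hx
    simp only [Finset.coe_filter, Finset.mem_filter, Finset.mem_product, Set.mem_ofPred_eq,
      Finset.coe_product, Set.mem_prod] at hx ⊢
    exact ⟨⟨⟨hx.1.1.1.1, hx.1.1.2.1⟩, hx.2⟩, ⟨hx.1.1.2.2, hx.1.1.1.2⟩, by linarith⟩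
  · intro x _ y _ hxy
    simp only [Prod.mk.injEq] at hxy
    exact Prod.ext (Prod.ext hxy.1.1 hxy.2.2) (Prod.ext hxy.1.2 hxy.2.1)

/-- Cauchy–Schwarz over the triples `(a, b, c)` grouped by `(a + b, c + b)` and weighted by the
square root of the number of representations of `a - c`. -/
theorem card_sq_mul_sum_sqrt_sq_le (B : Finset ℝ) :
    (B.card : ℝ) ^ 2 * (∑ z ∈ B - B, (diffRep B B z : ℝ) * √(diffRep B B z)) ^ 2 ≤
      (∑ z ∈ B - B, (diffRep B B z : ℝ) ^ 3) *
        ∑ z ∈ B - (B + B), (diffRep B (B + B) z : ℝ) ^ 2 := by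
  classical
  set P := B + B with hP
  let T := B ×ˢ (B ×ˢ B)
  let κ : ℝ × (ℝ × ℝ) → ℝ × ℝ := fun t => (t.1 + t.2.1, t.2.2 + t.2.1)
  have hκ : ∀ t ∈ T, κ t ∈ P ×ˢ P := by
    intro t ht
    simp only [T, Finset.mem_product] at ht
    exact Finset.mem_product.2 ⟨Finset.add_mem_add ht.1 ht.2.1, Finset.add_mem_add ht.2.2 ht.2.1⟩
  let F : ℝ × ℝ → ℝ := fun k => √(diffRep B B (k.1 - k.2))
  have e1 : (B.card : ℝ) * ∑ z ∈ B - B, (diffRep B B z : ℝ) * √(diffRep B B z) =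
      ∑ k ∈ P ×ˢ P, ((T.filter (fun t => κ t = k)).card : ℝ) * F k := by
    have h1 : ∑ t ∈ T, F (κ t) =
        ∑ k ∈ P ×ˢ P, ((T.filter (fun t => κ t = k)).card : ℝ) * F k := by
      rw [← Finset.sum_fiberwise_of_maps_to hκ]
      refine Finset.sum_congr rfl fun k _ => ?_
      rw [Finset.sum_congr rfl (g := fun _ => F k), Finset.sum_const, nsmul_eq_mul]
      intro t ht
      rw [(Finset.mem_filter.1 ht).2]
    rw [← h1]
    have hm : ∀ p ∈ B ×ˢ B, p.1 - p.2 ∈ B - B := fun p hp =>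
      Finset.sub_mem_sub (Finset.mem_product.1 hp).1 (Finset.mem_product.1 hp).2
    have h2 : ∑ p ∈ B ×ˢ B, √(diffRep B B (p.1 - p.2)) =
        ∑ z ∈ B - B, (diffRep B B z : ℝ) * √(diffRep B B z) := by
      rw [← Finset.sum_fiberwise_of_maps_to hm]
      refine Finset.sum_congr rfl fun k _ => ?_
      rw [Finset.sum_congr rfl (g := fun _ => √(diffRep B B k)), Finset.sum_const, nsmul_eq_mul]
      · rfl
      · intro t ht
        rw [(Finset.mem_filter.1 ht).2]
    rw [← h2, Finset.sum_product, Finset.mul_sum, Finset.sum_product]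
    refine Finset.sum_congr rfl fun a _ => ?_
    rw [Finset.sum_product]
    simp only [F, κ, add_sub_add_right_eq_sub]
    rw [Finset.sum_const, nsmul_eq_mul]
  rw [← mul_pow, e1]
  refine (Finset.sum_mul_sq_le_sq_mul_sq _ _ _).trans ?_
  have e2 : ∑ k ∈ P ×ˢ P, ((T.filter (fun t => κ t = k)).card : ℝ) ^ 2 ≤
      ∑ z ∈ B - B, (diffRep B B z : ℝ) ^ 3 := by
    have h1 := sum_card_fiber_sq T (P ×ˢ P) κ hκ
    have hm : ∀ x ∈ (T ×ˢ T).filter (fun x => κ x.1 = κ x.2), x.1.1 - x.2.1 ∈ B - B := by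
      intro x hx
      simp only [T, Finset.mem_filter, Finset.mem_product] at hx
      exact Finset.sub_mem_sub hx.1.1.1 hx.1.2.1
    rw [Finset.card_eq_sum_card_fiberwise hm] at h1
    have h2 : ∑ k ∈ P ×ˢ P, (T.filter (fun t => κ t = k)).card ^ 2 ≤
        ∑ z ∈ B - B, diffRep B B z ^ 3 := by
      rw [h1]
      refine Finset.sum_le_sum fun z _ => ?_
      have h3 : diffRep B B z ^ 3 = diffRep B B z * (diffRep B B z * diffRep B B z) := by ring
      rw [h3, diffRep, ← Finset.card_product, ← Finset.card_product]
      apply Finset.card_le_card_of_injOn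
        (fun x => ((x.1.1, x.2.1), ((x.2.2.1, x.1.2.1), (x.1.2.2, x.2.2.2))))
      · intro x hx
        simp only [κ, T, Finset.coe_filter, Finset.mem_filter, Finset.mem_product,
          Set.mem_ofPred_eq, Finset.coe_product, Set.mem_prod, Prod.mk.injEq] at hx ⊢
        obtain ⟨⟨⟨⟨ha, hb, hc⟩, ha', hb', hc'⟩, h4, h5⟩, h6⟩ := hx
        exact ⟨⟨⟨ha, ha'⟩, h6⟩, ⟨⟨hb', hb⟩, by linarith⟩, ⟨hc, hc'⟩, by linarith⟩
      · intro x _ y _ hxy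
        simp only [Prod.mk.injEq] at hxy
        obtain ⟨⟨h4, h5⟩, ⟨h6, h7⟩, h8, h9⟩ := hxy
        exact Prod.ext (Prod.ext h4 (Prod.ext h7 h8)) (Prod.ext h5 (Prod.ext h6 h9))
    exact_mod_cast h2
  have e3 : ∑ k ∈ P ×ˢ P, F k ^ 2 ≤ ∑ z ∈ B - P, (diffRep B P z : ℝ) ^ 2 := by
    have h0 : ∑ k ∈ P ×ˢ P, F k ^ 2 = ((∑ k ∈ P ×ˢ P, diffRep B B (k.1 - k.2) : ℕ) : ℝ) := by
      push_cast
      exact Finset.sum_congr rfl fun k _ => Real.sq_sqrt (Nat.cast_nonneg _)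
    let U := ((P ×ˢ P) ×ˢ (B ×ˢ B)).filter (fun x => x.2.1 - x.2.2 = x.1.1 - x.1.2)
    have h1 : ∑ k ∈ P ×ˢ P, diffRep B B (k.1 - k.2) = U.card := by
      have hm : ∀ x ∈ U, x.1 ∈ P ×ˢ P := fun x hx =>
        (Finset.mem_product.1 (Finset.mem_filter.1 hx).1).1
      rw [Finset.card_eq_sum_card_fiberwise hm]
      refine Finset.sum_congr rfl fun k hk => ?_
      refine Finset.card_bij' (fun p _ => (k, p)) (fun x _ => x.2) ?_ ?_ ?_ ?_
      · intro p hp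
        simp only [U, Finset.mem_filter, Finset.mem_product] at hp hk ⊢
        exact ⟨⟨⟨hk, hp.1⟩, hp.2⟩, trivial⟩
      · intro x hx
        simp only [U, Finset.mem_filter, Finset.mem_product] at hx ⊢
        rw [← hx.2]
        exact ⟨hx.1.1.2, hx.1.2⟩
      · intro p _
        rfl
      · intro x hx
        exact Prod.ext (Finset.mem_filter.1 hx).2.symm rfl
    have h2 : U.card ≤ ∑ z ∈ B - P, diffRep B P z ^ 2 := by
      have hm : ∀ x ∈ U, x.2.1 - x.1.1 ∈ B - P := fun x hx => by
        simp only [U, Finset.mem_filter, Finset.mem_product] at hx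
        exact Finset.sub_mem_sub hx.1.2.1 hx.1.1.1
      rw [Finset.card_eq_sum_card_fiberwise hm]
      refine Finset.sum_le_sum fun z _ => ?_
      rw [sq, diffRep, ← Finset.card_product]
      apply Finset.card_le_card_of_injOn (fun x => ((x.2.1, x.1.1), (x.2.2, x.1.2)))
      · intro x hx
        simp only [U, Finset.coe_filter, Finset.mem_filter, Finset.mem_product, Set.mem_ofPred_eq,
          Finset.coe_product, Set.mem_prod] at hx ⊢
        exact ⟨⟨⟨hx.1.1.2.1, hx.1.1.1.1⟩, hx.2⟩, ⟨hx.1.1.2.2, hx.1.1.1.2⟩, by linarith⟩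
      · intro x _ y _ hxy
        simp only [Prod.mk.injEq] at hxy
        exact Prod.ext (Prod.ext hxy.1.2 hxy.2.2) (Prod.ext hxy.1.1 hxy.2.1)
    rw [h0, h1]
    exact_mod_cast h2
  gcongr

/-- Interpolation of the second moment between the moments of order `3 / 2` and `3`. -/
theorem sum_sq_pow_three_le {ι : Type*} (s : Finset ι) (f : ι → ℝ) (hf : ∀ i ∈ s, 0 ≤ f i) :
    (∑ i ∈ s, f i ^ 2) ^ 3 ≤ (∑ i ∈ s, f i * √(f i)) ^ 2 * ∑ i ∈ s, f i ^ 3 := by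
  have h1 : (∑ i ∈ s, f i ^ 2) ^ 2 ≤ (∑ i ∈ s, f i * √(f i)) * ∑ i ∈ s, f i ^ 2 * √(f i) := by
    refine Finset.sum_sq_le_sum_mul_sum_of_sq_le_mul s (fun i hi => ?_) (fun i hi => ?_)
      (fun i hi => le_of_eq ?_)
    · exact mul_nonneg (hf i hi) (Real.sqrt_nonneg _)
    · exact mul_nonneg (sq_nonneg _) (Real.sqrt_nonneg _)
    · have := Real.mul_self_sqrt (hf i hi)
      calc (f i ^ 2) ^ 2 = f i ^ 3 * f i := by ring
        _ = f i ^ 3 * (√(f i) * √(f i)) := by rw [this]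
        _ = _ := by ring
  have h2 : (∑ i ∈ s, f i ^ 2 * √(f i)) ^ 2 ≤ (∑ i ∈ s, f i ^ 2) * ∑ i ∈ s, f i ^ 3 := by
    refine Finset.sum_sq_le_sum_mul_sum_of_sq_le_mul s (fun i hi => ?_) (fun i hi => ?_)
      (fun i hi => le_of_eq ?_)
    · exact sq_nonneg _
    · exact pow_nonneg (hf i hi) _
    · rw [mul_pow, Real.sq_sqrt (hf i hi)]
      ring
  set e := ∑ i ∈ s, f i ^ 2
  set u := ∑ i ∈ s, f i * √(f i)
  set v := ∑ i ∈ s, f i ^ 2 * √(f i)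
  set w := ∑ i ∈ s, f i ^ 3
  have he : 0 ≤ e := Finset.sum_nonneg fun _ _ => sq_nonneg _
  have hw : 0 ≤ w := Finset.sum_nonneg fun i hi => pow_nonneg (hf i hi) _
  rcases he.eq_or_lt with h0 | h0
  · rw [← h0, zero_pow (by norm_num)]
    positivity
  · refine le_of_mul_le_mul_left ?_ h0
    calc e * e ^ 3 = (e ^ 2) ^ 2 := by ring
      _ ≤ (u * v) ^ 2 := by gcongr
      _ = u ^ 2 * v ^ 2 := by ring
      _ ≤ u ^ 2 * (e * w) := by gcongr
      _ = _ := by ring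

/-- Few products, many sums: if every element of `B` has at least `h` representations as a
quotient of elements of `H`, then the sumset of `B` is large. For `h` comparable to `|H|` this reads
`|B|^(19/9) ≲ |H|^(5/9) |B + B|`, past the Szemerédi–Trotter bound. -/
theorem card_pow_le_of_quotient_reps (B H : Finset ℝ) (hH : ∀ q ∈ H, 0 < q) {h : ℕ} (hh : 1 ≤ h)
    (hB : ∀ a ∈ B, h ≤ (H.filter (fun q => a * q ∈ H)).card)
    (hBH : B.card ≤ H.card) {n : ℕ} (hn : B.card ≤ n) :
    (h : ℝ) ^ 15 * (B.card : ℝ) ^ 19 ≤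
      256 ^ 5 * ((Nat.log 2 n + 1 : ℕ) : ℝ) ^ 4 * (H.card : ℝ) ^ 20 * ((B + B).card : ℝ) ^ 9 := by
  rcases B.eq_empty_or_nonempty with rfl | hBne
  · simp
  have i1 := energy_sq_le B (B + B) H hH hh hB hBH
  have i2 : (h : ℝ) ^ 3 * ∑ z ∈ B - B, (diffRep B B z : ℝ) ^ 3 ≤
      256 * ((Nat.log 2 n + 1 : ℕ) : ℝ) * (H.card : ℝ) ^ 4 * (B.card : ℝ) ^ 2 := by
    exact_mod_cast sum_diffRep_cube_le B H hH hh hB hn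
  have i3 : (B.card : ℝ) ^ 4 ≤ (B + B).card * ∑ z ∈ B - B, (diffRep B B z : ℝ) ^ 2 := by
    exact_mod_cast card_pow_four_le_energy B
  have i4 := card_sq_mul_sum_sqrt_sq_le B
  have i5 := sum_sq_pow_three_le (B - B) (fun z => (diffRep B B z : ℝ)) (fun _ _ => by positivity)
  have hN : (0 : ℝ) < B.card := by exact_mod_cast hBne.card_pos
  have hE0 : 0 ≤ ∑ z ∈ B - (B + B), (diffRep B (B + B) z : ℝ) ^ 2 :=
    Finset.sum_nonneg fun _ _ => sq_nonneg _
  have he3 : 0 ≤ ∑ z ∈ B - B, (diffRep B B z : ℝ) ^ 3 :=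
    Finset.sum_nonneg fun _ _ => by positivity
  have he2 : 0 ≤ ∑ z ∈ B - B, (diffRep B B z : ℝ) ^ 2 :=
    Finset.sum_nonneg fun _ _ => by positivity
  generalize ∑ z ∈ B - (B + B), (diffRep B (B + B) z : ℝ) ^ 2 = E at *
  generalize ∑ z ∈ B - B, (diffRep B B z : ℝ) ^ 3 = e₃ at *
  generalize ∑ z ∈ B - B, (diffRep B B z : ℝ) ^ 2 = e₂ at *
  generalize ∑ z ∈ B - B, (diffRep B B z : ℝ) * √(diffRep B B z) = s at *
  generalize ((Nat.log 2 n + 1 : ℕ) : ℝ) = l at *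
  generalize ((B + B).card : ℝ) = P at *
  generalize (B.card : ℝ) = N at *
  generalize (H.card : ℝ) = η at *
  have hP : 0 ≤ P := by
    by_contra hP
    push Not at hP
    nlinarith [pow_pos hN 4]
  have j1 : N ^ 2 * e₂ ^ 3 ≤ e₃ ^ 2 * E := by
    calc N ^ 2 * e₂ ^ 3 ≤ N ^ 2 * (s ^ 2 * e₃) := by gcongr
      _ = N ^ 2 * s ^ 2 * e₃ := by ring
      _ ≤ e₃ * E * e₃ := by gcongr
      _ = _ := by ring
  refine le_of_mul_le_mul_left ?_ (pow_pos hN 9)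
  have hh0 : (0 : ℝ) ≤ h := Nat.cast_nonneg _
  calc N ^ 9 * ((h : ℝ) ^ 15 * N ^ 19) = (h : ℝ) ^ 15 * N ^ 4 * (N ^ 4) ^ 6 := by ring
    _ ≤ (h : ℝ) ^ 15 * N ^ 4 * (P * e₂) ^ 6 := by gcongr
    _ = P ^ 6 * h ^ 15 * (N ^ 2 * e₂ ^ 3) ^ 2 := by ring
    _ ≤ P ^ 6 * h ^ 15 * (e₃ ^ 2 * E) ^ 2 := by gcongr
    _ = P ^ 6 * ((h : ℝ) ^ 3 * e₃) ^ 4 * ((h : ℝ) ^ 3 * E ^ 2) := by ring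
    _ ≤ P ^ 6 * (256 * l * η ^ 4 * N ^ 2) ^ 4 * (256 * η ^ 4 * N * P ^ 3) := by gcongr
    _ = _ := by ring

/-! ### Multiplicative energy of sets with many additive relations -/

/-- The number of points of the grid `Y × Y` on the line of slope `μ` and intercept `β`. -/
noncomputable def lineRep (Y : Finset ℝ) (μ β : ℝ) : ℕ :=
  ((Y ×ˢ Y).filter (fun p => p.2 - μ * p.1 = β)).card

/-- The weighted number of pairs `(x, x')` in `X × X` with `x' = μ x`. -/
noncomputable def weightedRatioRep (X : Finset ℝ) (w : ℝ → ℕ) (μ : ℝ) : ℕ :=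
  ∑ p ∈ (X ×ˢ X).filter (fun p => p.2 = μ * p.1), w p.1 * w p.2

/-- The number of `y ∈ Y` with `x + y ∈ Z`. -/
noncomputable def sumDegree (Y Z : Finset ℝ) (x : ℝ) : ℕ :=
  (Y.filter (fun y => x + y ∈ Z)).card

theorem sum_lineRep_sq_le (Y M I : Finset ℝ) (hM : ∀ μ ∈ M, 0 < μ) {r : ℕ} (hr : 1 ≤ r) :
    r * ∑ μ ∈ M, ∑ β ∈ I, lineRep Y μ β ^ 2 ≤
      2 * r ^ 2 * (M.card * Y.card ^ 2) + 8 * Y.card ^ 4 := by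
  classical
  let S : ℝ × ℝ → Finset (ℝ × ℝ) := fun l => (Y ×ˢ Y).filter (fun p => p.2 - l.1 * p.1 = l.2)
  have hinc := sum_card_sq_chains_le (M ×ˢ I) Y Y S (fun l _ => Finset.filter_subset _ _)
    (by
      rintro ⟨μ, β⟩ hl p hp q hq
      simp only [S, Finset.mem_filter, Finset.mem_product] at hl hp hq
      have hμ := hM μ hl.1
      have h1 : p.2 - q.2 = μ * (p.1 - q.1) := by linarith [hp.2, hq.2]
      constructor
      · intro h
        nlinarith
      · intro h
        by_contra h2
        push Not at h2
        nlinarith)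
    (by
      rintro ⟨μ, β⟩ hl ⟨μ', β'⟩ hl' p hp q hq hp' hq' hne
      simp only [S, Finset.mem_filter, Finset.mem_product] at hl hl' hp hq hp' hq'
      have hne1 : p.1 - q.1 ≠ 0 := by
        intro h0
        apply hne
        have h1 : p.1 = q.1 := by linarith
        refine Prod.ext h1 ?_
        have h2 := hp.2.trans hq.2.symm
        rw [h1] at h2
        linarith
      have h3 : μ = μ' := by
        apply mul_right_cancel₀ hne1
        linarith [hp.2, hq.2, hp'.2, hq'.2]
      subst h3
      rw [Prod.mk.injEq]
      exact ⟨rfl, hp.2.symm.trans hp'.2⟩) hr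
  rw [Finset.sum_product, Finset.sum_product] at hinc
  have h1 : ∀ μ ∈ M, ∑ β ∈ I, (S (μ, β)).card ≤ Y.card ^ 2 := by
    intro μ _
    rw [sq, ← Finset.card_product, ← Finset.card_biUnion]
    · exact Finset.card_le_card (Finset.biUnion_subset.2 fun β _ => Finset.filter_subset _ _)
    · intro β _ β' _ hne
      rw [Function.onFun, Finset.disjoint_left]
      intro p hp hp'
      exact hne ((Finset.mem_filter.1 hp).2.symm.trans (Finset.mem_filter.1 hp').2)
  have h2 := Finset.sum_le_sum h1
  rw [Finset.sum_const, smul_eq_mul] at h2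
  calc r * ∑ μ ∈ M, ∑ β ∈ I, lineRep Y μ β ^ 2
      ≤ 2 * r ^ 2 * ∑ μ ∈ M, ∑ β ∈ I, (S (μ, β)).card + 8 * Y.card ^ 2 * Y.card ^ 2 := hinc
    _ ≤ 2 * r ^ 2 * (M.card * Y.card ^ 2) + 8 * Y.card ^ 2 * Y.card ^ 2 := by gcongr
    _ = _ := by ring

/-- If `x' = μ x`, the points `(y, y')` and `(x + y, x' + y')` lie on a common line of slope `μ`. -/
theorem weightedRatioRep_sumDegree_le (X Y Z : Finset ℝ) (μ : ℝ) (I : Finset ℝ)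
    (hI : ∀ y ∈ Y, ∀ y' ∈ Y, y' - μ * y ∈ I) :
    weightedRatioRep X (sumDegree Y Z) μ ≤ ∑ β ∈ I, lineRep Y μ β * lineRep Z μ β := by
  classical
  let D : ℝ → Finset ℝ := fun x => Y.filter (fun y => x + y ∈ Z)
  let U := ((X ×ˢ X).filter (fun p => p.2 = μ * p.1)).sigma (fun p => D p.1 ×ˢ D p.2)
  have h1 : weightedRatioRep X (sumDegree Y Z) μ = U.card := by
    rw [Finset.card_sigma]
    exact Finset.sum_congr rfl fun p _ => (Finset.card_product _ _).symm
  have hm : ∀ u ∈ U, u.2.2 - μ * u.2.1 ∈ I := by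
    intro u hu
    simp only [U, D, Finset.mem_sigma, Finset.mem_filter, Finset.mem_product] at hu
    exact hI _ hu.2.1.1 _ hu.2.2.1
  rw [h1, Finset.card_eq_sum_card_fiberwise hm]
  refine Finset.sum_le_sum fun β _ => ?_
  rw [lineRep, lineRep, ← Finset.card_product]
  apply Finset.card_le_card_of_injOn (fun u => (u.2, (u.1.1 + u.2.1, u.1.2 + u.2.2)))
  · intro u hu
    simp only [U, D, Finset.coe_filter, Finset.mem_sigma, Finset.mem_filter, Finset.mem_product,
      Set.mem_ofPred_eq, Finset.coe_product, Set.mem_prod] at hu ⊢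
    obtain ⟨⟨⟨-, h2⟩, ⟨h3, h4⟩, h5, h6⟩, h7⟩ := hu
    refine ⟨⟨⟨h3, h5⟩, h7⟩, ⟨h4, h6⟩, ?_⟩
    rw [h2]
    linarith
  · rintro ⟨p, q⟩ _ ⟨p', q'⟩ _ h
    simp only [Prod.mk.injEq] at h
    obtain ⟨rfl, h2, h3⟩ := h
    have : p = p' := Prod.ext (add_right_cancel h2) (add_right_cancel h3)
    rw [this]

/-- The Elekes–Ruzsa argument: if sums `x + y` fall into `Z`, with `X`, `Y`, `Z` of size at most
`2 t`, then the weighted ratios of `X` spread out over many slopes. -/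
theorem sum_weightedRatioRep_sq_le (X Y Z M : Finset ℝ) {t : ℕ} (ht : 1 ≤ t)
    (hY : Y.card ≤ 2 * t) (hZ : Z.card ≤ 2 * t) (hM : ∀ μ ∈ M, 0 < μ)
    (hMt : M.card ≤ 4 * t ^ 2) :
    (∑ μ ∈ M, weightedRatioRep X (sumDegree Y Z) μ) ^ 2 ≤ 40000 * t ^ 6 * M.card := by
  classical
  rcases M.eq_empty_or_nonempty with rfl | hMne
  · simp
  let I := (M ×ˢ (Y ×ˢ Y)).image (fun x => x.2.2 - x.1 * x.2.1)
  set W := ∑ μ ∈ M, weightedRatioRep X (sumDegree Y Z) μ with hW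
  have h1 : 2 * W ≤ ∑ μ ∈ M, ∑ β ∈ I, lineRep Y μ β ^ 2 + ∑ μ ∈ M, ∑ β ∈ I, lineRep Z μ β ^ 2 := by
    rw [hW, Finset.mul_sum, ← Finset.sum_add_distrib]
    refine Finset.sum_le_sum fun μ hμ => ?_
    have hI : ∀ y ∈ Y, ∀ y' ∈ Y, y' - μ * y ∈ I := fun y hy y' hy' =>
      Finset.mem_image.2 ⟨(μ, (y, y')), by simp [hμ, hy, hy'], rfl⟩
    refine (Nat.mul_le_mul_left 2 (weightedRatioRep_sumDegree_le X Y Z μ I hI)).trans ?_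
    rw [Finset.mul_sum, ← Finset.sum_add_distrib]
    refine Finset.sum_le_sum fun β _ => ?_
    rw [← mul_assoc]
    exact two_mul_le_add_sq _ _
  have h2 : ∀ r : ℕ, 1 ≤ r → r * W ≤ 8 * r ^ 2 * (M.card * t ^ 2) + 128 * t ^ 4 := by
    intro r hr
    have hY' := sum_lineRep_sq_le Y M I hM hr
    have hZ' := sum_lineRep_sq_le Z M I hM hr
    have e : ∀ V : Finset ℝ, V.card ≤ 2 * t → 2 * r ^ 2 * (M.card * V.card ^ 2) + 8 * V.card ^ 4 ≤
        8 * r ^ 2 * (M.card * t ^ 2) + 128 * t ^ 4 := by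
      intro V hV
      calc 2 * r ^ 2 * (M.card * V.card ^ 2) + 8 * V.card ^ 4
          ≤ 2 * r ^ 2 * (M.card * (2 * t) ^ 2) + 8 * (2 * t) ^ 4 := by gcongr
        _ = _ := by ring
    have := e Y hY
    have := e Z hZ
    have := Nat.mul_le_mul_left r h1
    rw [mul_add] at this
    linarith
  have ht' : (1 : ℝ) ≤ t := by exact_mod_cast ht
  have hc : (1 : ℝ) ≤ M.card := by exact_mod_cast hMne.card_pos
  have hct : (M.card : ℝ) ≤ 4 * (t : ℝ) ^ 2 := by exact_mod_cast hMt
  suffices h : (W : ℝ) ^ 2 ≤ 40000 * (t : ℝ) ^ 6 * M.card by exact_mod_cast h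
  set c : ℝ := (M.card : ℝ)
  -- the number of cells that balances the two terms of `h2`
  set ρ : ℝ := √((t : ℝ) ^ 2 / c) with hρ
  have hρ2 : ρ ^ 2 * c = (t : ℝ) ^ 2 := by
    rw [hρ, Real.sq_sqrt (by positivity), div_mul_cancel₀ _ (by positivity)]
  have hρ1 : 1 / 2 ≤ ρ := by
    rw [hρ]
    apply Real.le_sqrt_of_sq_le
    rw [le_div_iff₀ (by positivity)]
    linarith
  have hr1 : 1 ≤ ⌈ρ⌉₊ := Nat.one_le_ceil_iff.2 (by linarith)
  have hr2 : ρ ≤ ⌈ρ⌉₊ := Nat.le_ceil ρ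
  have hr3 : (⌈ρ⌉₊ : ℝ) ≤ 3 * ρ := by
    have := Nat.ceil_lt_add_one (a := ρ) (by linarith)
    linarith
  have h0 := (Nat.cast_le (α := ℝ)).2 (h2 ⌈ρ⌉₊ hr1)
  push_cast at h0
  have h3 : ρ * W ≤ 200 * (t : ℝ) ^ 4 := by
    calc ρ * W ≤ ⌈ρ⌉₊ * W := by gcongr
      _ ≤ 8 * (⌈ρ⌉₊ : ℝ) ^ 2 * (c * (t : ℝ) ^ 2) + 128 * (t : ℝ) ^ 4 := h0
      _ ≤ 8 * (3 * ρ) ^ 2 * (c * (t : ℝ) ^ 2) + 128 * (t : ℝ) ^ 4 := by gcongr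
      _ = 72 * (ρ ^ 2 * c) * (t : ℝ) ^ 2 + 128 * (t : ℝ) ^ 4 := by ring
      _ = _ := by rw [hρ2]; ring
  have ht2 : (0 : ℝ) < (t : ℝ) ^ 2 := by positivity
  refine le_of_mul_le_mul_left ?_ ht2
  calc (t : ℝ) ^ 2 * (W : ℝ) ^ 2 = (ρ * W) ^ 2 * c := by rw [← hρ2]; ring
    _ ≤ (200 * (t : ℝ) ^ 4) ^ 2 * c := by gcongr
    _ = _ := by ring

theorem weightedRatioRep_le (X : Finset ℝ) (w : ℝ → ℕ) {D : ℕ} (hw : ∀ x ∈ X, w x ≤ D) (μ : ℝ) :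
    weightedRatioRep X w μ ≤ X.card ^ 2 * D ^ 2 := by
  classical
  calc weightedRatioRep X w μ
      ≤ ∑ p ∈ (X ×ˢ X).filter (fun p => p.2 = μ * p.1), D ^ 2 := by
        refine Finset.sum_le_sum fun p hp => ?_
        have := Finset.mem_product.1 (Finset.mem_filter.1 hp).1
        rw [sq]
        exact Nat.mul_le_mul (hw _ this.1) (hw _ this.2)
    _ ≤ ∑ p ∈ X ×ˢ X, D ^ 2 := Finset.sum_le_sum_of_subset (Finset.filter_subset _ _)
    _ = _ := by rw [Finset.sum_const, Finset.card_product, smul_eq_mul, sq X.card]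

/-- A bound for the weighted multiplicative energy of `X`, where the weight of `x` is its number of
additive relations `x + y ∈ Z`. -/
theorem weighted_energy_le (X Y Z : Finset ℝ) (hX : ∀ x ∈ X, 0 < x) {t n : ℕ} (ht : 1 ≤ t)
    (htn : t ≤ n) (hXt : X.card ≤ 2 * t) (hY : Y.card ≤ 2 * t) (hZ : Z.card ≤ 2 * t) :
    ∑ μ ∈ X / X, weightedRatioRep X (sumDegree Y Z) μ ^ 2 ≤
      640000 * (Nat.log 2 n + 1) * t ^ 6 := by
  classical
  set g := weightedRatioRep X (sumDegree Y Z) with hg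
  set l := Nat.log 2 n + 1 with hl
  have hpos : ∀ μ ∈ X / X, 0 < μ := by
    intro μ hμ
    obtain ⟨a, ha, b, hb, rfl⟩ := Finset.mem_div.1 hμ
    exact div_pos (hX a ha) (hX b hb)
  have hcard : (X / X).card ≤ 4 * t ^ 2 := by
    refine Finset.card_div_le.trans ?_
    nlinarith
  have hgle : ∀ μ, g μ ≤ 16 * n ^ 4 := by
    intro μ
    refine (weightedRatioRep_le X (sumDegree Y Z) (D := Y.card)
      (fun x _ => Finset.card_filter_le _ _) μ).trans ?_
    calc X.card ^ 2 * Y.card ^ 2 ≤ (2 * n) ^ 2 * (2 * n) ^ 2 := by gcongr <;> omega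
      _ = _ := by ring
  have hn : n < 2 ^ l := Nat.lt_pow_succ_log_self (by norm_num) n
  have hm : ∀ μ ∈ (X / X).filter (fun μ => g μ ≠ 0), Nat.log 2 (g μ) ∈ Finset.range (8 * l) := by
    intro μ hμ
    rw [Finset.mem_range]
    refine Nat.log_lt_of_lt_pow (Finset.mem_filter.1 hμ).2 ((hgle μ).trans_lt ?_)
    calc 16 * n ^ 4 < 16 * (2 ^ l) ^ 4 := by gcongr
      _ = 2 ^ (4 + l * 4) := by rw [pow_add 2 4, pow_mul 2 l 4]; norm_num
      _ ≤ 2 ^ (8 * l) := Nat.pow_le_pow_right (by norm_num) (by omega)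
  have hsplit : ∑ μ ∈ X / X, g μ ^ 2 = ∑ μ ∈ (X / X).filter (fun μ => g μ ≠ 0), g μ ^ 2 := by
    rw [Finset.sum_filter_of_ne]
    intro μ _ h h0
    simp [h0] at h
  rw [hsplit, ← Finset.sum_fiberwise_of_maps_to hm]
  have hclass : ∀ j ∈ Finset.range (8 * l), ∑ μ ∈ ((X / X).filter (fun μ => g μ ≠ 0)).filter
      (fun μ => Nat.log 2 (g μ) = j), g μ ^ 2 ≤ 80000 * t ^ 6 := by
    intro j _
    set M := ((X / X).filter (fun μ => g μ ≠ 0)).filter (fun μ => Nat.log 2 (g μ) = j) with hM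
    have hsub : M ⊆ X / X := (Finset.filter_subset _ _).trans (Finset.filter_subset _ _)
    have hrange : ∀ μ ∈ M, 2 ^ j ≤ g μ ∧ g μ ≤ 2 * 2 ^ j := by
      intro μ hμ
      simp only [hM, Finset.mem_filter] at hμ
      have h2 := Nat.pow_log_le_self 2 hμ.1.2
      have h3 := Nat.lt_pow_succ_log_self (b := 2) (by norm_num) (g μ)
      rw [hμ.2] at h2 h3
      rw [pow_succ'] at h3
      exact ⟨h2, h3.le⟩
    have h1 := sum_weightedRatioRep_sq_le X Y Z M ht hY hZ (fun μ hμ => hpos μ (hsub hμ))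
      ((Finset.card_le_card hsub).trans hcard)
    rw [← hg] at h1
    set W := ∑ μ ∈ M, g μ with hW
    have h2 : M.card * 2 ^ j ≤ W := Finset.card_nsmul_le_sum _ _ _ fun μ hμ => (hrange μ hμ).1
    have h3 : ∑ μ ∈ M, g μ ^ 2 ≤ 2 * (2 ^ j * W) := by
      rw [hW, Finset.mul_sum, Finset.mul_sum]
      refine Finset.sum_le_sum fun μ hμ => ?_
      rw [sq, ← mul_assoc]
      exact Nat.mul_le_mul_right _ (hrange μ hμ).2
    have h4 : 2 ^ j * W ≤ 40000 * t ^ 6 := by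
      rcases Nat.eq_zero_or_pos W with h0 | h0
      · simp [h0]
      · refine Nat.le_of_mul_le_mul_right ?_ h0
        calc 2 ^ j * W * W = 2 ^ j * W ^ 2 := by ring
          _ ≤ 2 ^ j * (40000 * t ^ 6 * M.card) := Nat.mul_le_mul_left _ h1
          _ = 40000 * t ^ 6 * (M.card * 2 ^ j) := by ring
          _ ≤ _ := Nat.mul_le_mul_left _ h2
    omega
  refine (Finset.sum_le_sum hclass).trans (le_of_eq ?_)
  rw [Finset.sum_const, Finset.card_range, smul_eq_mul]
  ring

/-! ### Sums of points on clusters of lines -/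

/-- The abscissae of the points of `A × A` on the line through the origin of slope `i`. -/
noncomputable def ray (A : Finset ℝ) (i : ℝ) : Finset ℝ := A.filter (fun x => i * x ∈ A)

/-- The vector sums of points of `A × A` on the two lines of slopes `i` and `j`. -/
noncomputable def raySum (A : Finset ℝ) (i j : ℝ) : Finset (ℝ × ℝ) :=
  (ray A i ×ˢ ray A j).image (fun p => (p.1 + p.2, i * p.1 + j * p.2))

theorem raySum_comm (A : Finset ℝ) (i j : ℝ) : raySum A i j = raySum A j i := by
  classical
  ext z
  simp only [raySum, Finset.mem_image, Finset.mem_product]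
  constructor
  · rintro ⟨⟨x, y⟩, ⟨hx, hy⟩, rfl⟩
    exact ⟨(y, x), ⟨hy, hx⟩, by simp [add_comm]⟩
  · rintro ⟨⟨x, y⟩, ⟨hx, hy⟩, rfl⟩
    exact ⟨(y, x), ⟨hy, hx⟩, by simp [add_comm]⟩

theorem card_raySum (A : Finset ℝ) {i j : ℝ} (hij : i ≠ j) :
    (raySum A i j).card = (ray A i).card * (ray A j).card := by
  classical
  rw [raySum, Finset.card_image_of_injective, Finset.card_product]
  rintro ⟨x, y⟩ ⟨x', y'⟩ h
  simp only [Prod.mk.injEq] at h ⊢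
  have h1 : (i - j) * (x - x') = 0 := by linear_combination h.2 - j * h.1
  have h2 : x - x' = 0 := (mul_eq_zero.1 h1).resolve_left (sub_ne_zero.2 hij)
  constructor <;> linarith [h.1]

theorem raySum_subset (A : Finset ℝ) (i j : ℝ) : raySum A i j ⊆ (A + A) ×ˢ (A + A) := by
  classical
  intro z hz
  simp only [raySum, ray, Finset.mem_image, Finset.mem_product, Finset.mem_filter] at hz
  obtain ⟨p, ⟨h1, h2⟩, rfl⟩ := hz
  exact Finset.mem_product.2 ⟨Finset.add_mem_add h1.1 h2.1, Finset.add_mem_add h1.2 h2.2⟩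

theorem raySum_cone {A : Finset ℝ} (hA : ∀ x ∈ A, 0 < x) {i j : ℝ} (hij : i < j) {z : ℝ × ℝ}
    (hz : z ∈ raySum A i j) : i * z.1 < z.2 ∧ z.2 < j * z.1 := by
  classical
  simp only [raySum, ray, Finset.mem_image, Finset.mem_product, Finset.mem_filter] at hz
  obtain ⟨p, ⟨h1, h2⟩, rfl⟩ := hz
  have := hA _ h1.1
  have := hA _ h2.1
  constructor <;> simp only <;> nlinarith

/-- If the overlaps of distinct sets are at most `T / |I|`, where every set has at least `T`
elements, then the union is at least half as large as `|I|` disjoint sets of size `T`. -/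
theorem card_biUnion_ge {ι α : Type*} [DecidableEq α] (I : Finset ι) (W : ι → Finset α)
    {T : ℕ} (hT : ∀ i ∈ I, T ≤ (W i).card)
    (hover : ∀ i ∈ I, ∀ j ∈ I, i ≠ j → I.card * (W i ∩ W j).card ≤ T) :
    I.card * T ≤ 2 * (I.biUnion W).card := by
  classical
  set V := I.biUnion W with hV
  set U := ∑ i ∈ I, (W i).card with hU
  have hTU : I.card * T ≤ U := Finset.card_nsmul_le_sum _ _ _ hT
  have hf : ∀ i ∈ I, V.filter (fun z => z ∈ W i) = W i := by
    intro i hi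
    ext z
    simp only [Finset.mem_filter, hV, Finset.mem_biUnion]
    exact ⟨fun h => h.2, fun h => ⟨⟨i, hi, h⟩, h⟩⟩
  have e1 : ∑ z ∈ V, (I.filter (fun i => z ∈ W i)).card = U := by
    have h1 := Finset.sum_card_bipartiteAbove_eq_sum_card_bipartiteBelow
      (s := I) (t := V) (fun i z => z ∈ W i)
    simp only [Finset.bipartiteAbove, Finset.bipartiteBelow] at h1
    rw [← h1, hU]
    exact Finset.sum_congr rfl fun i hi => by rw [hf i hi]
  have e2 : ∑ z ∈ V, (I.filter (fun i => z ∈ W i)).card ^ 2 =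
      ∑ i ∈ I, ∑ j ∈ I, (W i ∩ W j).card := by
    have h1 := Finset.sum_card_bipartiteAbove_eq_sum_card_bipartiteBelow
      (s := I ×ˢ I) (t := V) (fun p z => z ∈ W p.1 ∧ z ∈ W p.2)
    simp only [Finset.bipartiteAbove, Finset.bipartiteBelow] at h1
    rw [← Finset.sum_product', Finset.sum_congr rfl (g := fun z =>
      ((I ×ˢ I).filter (fun p => z ∈ W p.1 ∧ z ∈ W p.2)).card), ← h1]
    · refine Finset.sum_congr rfl fun p hp => ?_
      congr 1
      rw [← Finset.filter_filter, hf _ (Finset.mem_product.1 hp).1, Finset.filter_mem_eq_inter]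
    · intro z _
      rw [sq, ← Finset.card_product]
      congr 1
      ext p
      simp only [Finset.mem_product, Finset.mem_filter]
      tauto
  have e3 : ∑ i ∈ I, ∑ j ∈ I, (W i ∩ W j).card ≤ 2 * U := by
    have h1 : ∀ i ∈ I, ∑ j ∈ I, (W i ∩ W j).card ≤ (W i).card + T := by
      intro i hi
      rw [← Finset.add_sum_erase I _ hi, Finset.inter_self]
      refine Nat.add_le_add_left ?_ _
      refine Nat.le_of_mul_le_mul_left ?_ (Finset.card_pos.2 ⟨i, hi⟩)
      rw [Finset.mul_sum]
      refine (Finset.sum_le_card_nsmul _ _ T fun j hj => ?_).trans ?_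
      · exact hover i hi j (Finset.mem_of_mem_erase hj) (Finset.ne_of_mem_erase hj).symm
      · rw [smul_eq_mul]
        exact Nat.mul_le_mul_right _ (Finset.card_le_card (Finset.erase_subset _ _))
    refine (Finset.sum_le_sum h1).trans ?_
    rw [Finset.sum_add_distrib, Finset.sum_const, smul_eq_mul]
    omega
  have e4 : U ^ 2 ≤ V.card * (2 * U) := by
    rw [← e1]
    refine sq_sum_le_card_mul_sum_sq.trans (Nat.mul_le_mul_left _ ?_)
    rw [e2, e1]
    exact e3
  rcases Nat.eq_zero_or_pos U with h0 | h0
  · omega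
  · have : U ≤ 2 * V.card := by
      refine Nat.le_of_mul_le_mul_right ?_ h0
      linarith
    omega

theorem card_filter_lt_pairs (s : Finset ℝ) :
    2 * ((s ×ˢ s).filter (fun p => p.1 < p.2)).card = s.card * (s.card - 1) := by
  classical
  have h1 : ((s ×ˢ s).filter (fun p => p.1 < p.2)).card =
      ((s ×ˢ s).filter (fun p => p.2 < p.1)).card := by
    refine Finset.card_bij' (fun p _ => p.swap) (fun p _ => p.swap) ?_ ?_ ?_ ?_ <;>
      intro p <;> simp +contextual
  have h2 : s.offDiag = (s ×ˢ s).filter (fun p => p.1 < p.2) ∪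
      (s ×ˢ s).filter (fun p => p.2 < p.1) := by
    ext p
    simp only [Finset.mem_offDiag, Finset.mem_union, Finset.mem_filter, Finset.mem_product,
      ne_iff_lt_or_gt]
    tauto
  have h3 := Finset.offDiag_card s
  rw [h2, Finset.card_union_of_disjoint, ← h1, ← two_mul] at h3
  · rw [h3, Nat.mul_sub, mul_one]
  · rw [Finset.disjoint_left]
    intro p hp hp'
    exact lt_asymm (Finset.mem_filter.1 hp).2 (Finset.mem_filter.1 hp').2

/-- The `m` smallest elements of a finite set of reals. -/
theorem exists_initial_subset (S : Finset ℝ) {m : ℕ} (hm : m ≤ S.card) :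
    ∃ Λ ⊆ S, Λ.card = m ∧ ∀ i ∈ Λ, ∀ j ∈ S \ Λ, i < j := by
  classical
  induction m with
  | zero => exact ⟨∅, by simp, rfl, by simp⟩
  | succ m ih =>
    obtain ⟨Λ, h1, h2, h3⟩ := ih (by omega)
    have hne : (S \ Λ).Nonempty := by
      rw [← Finset.card_pos, Finset.card_sdiff_of_subset h1]
      omega
    set x := (S \ Λ).min' hne
    have hx : x ∈ S \ Λ := Finset.min'_mem _ _
    have hx' := Finset.mem_sdiff.1 hx
    refine ⟨insert x Λ, Finset.insert_subset hx'.1 h1, ?_, ?_⟩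
    · rw [Finset.card_insert_of_notMem hx'.2, h2]
    · intro i hi j hj
      simp only [Finset.mem_sdiff, Finset.mem_insert, not_or] at hj
      have hj' : j ∈ S \ Λ := Finset.mem_sdiff.2 ⟨hj.1, hj.2.2⟩
      rcases Finset.mem_insert.1 hi with rfl | hi
      · exact lt_of_le_of_ne (Finset.min'_le _ _ hj') (Ne.symm hj.2.1)
      · exact h3 i hi j hj'

/-- Solymosi's argument with clusters of `m` consecutive slopes. The sums of points on two lines of
a cluster lie in the cone spanned by the cluster, and cones of different clusters are disjoint. If
the sums from different pairs of lines seldom coincide, every cluster contributes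
`m (m - 1) t² / 4` sums. -/
theorem clusters_le_card_sumset_sq {A : Finset ℝ} (hA : ∀ x ∈ A, 0 < x) {t m : ℕ}
    (k : ℕ) (S : Finset ℝ) (hS : ∀ i ∈ S, t ≤ (ray A i).card)
    (hover : ∀ i ∈ S, ∀ j ∈ S, ∀ k ∈ S, ∀ l ∈ S, i < j → k < l → (i, j) ≠ (k, l) →
      m * (m - 1) * (raySum A i j ∩ raySum A k l).card ≤ 2 * t ^ 2)
    (hk : k * m ≤ S.card) :
    k * (m * (m - 1) * t ^ 2) ≤
      4 * (((A + A) ×ˢ (A + A)).filter (fun z => ∃ i ∈ S, i * z.1 < z.2)).card := by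
  classical
  induction k generalizing S with
  | zero => simp
  | succ k ih =>
    have hmS : m ≤ S.card := by nlinarith
    obtain ⟨Λ, hΛS, hΛm, hΛ⟩ := exists_initial_subset S hmS
    have hsd : S \ Λ ⊆ S := Finset.sdiff_subset
    have h1 := ih (S \ Λ) (fun i hi => hS i (hsd hi))
      (fun i hi j hj k hk l hl => hover i (hsd hi) j (hsd hj) k (hsd hk) l (hsd hl)) (by
        rw [Finset.card_sdiff_of_subset hΛS, hΛm]
        have : (k + 1) * m = k * m + m := by ring
        omega)
    set I := (Λ ×ˢ Λ).filter (fun p => p.1 < p.2) with hI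
    have hIc : 2 * I.card = m * (m - 1) := by rw [hI, card_filter_lt_pairs, hΛm]
    have h2 : I.card * t ^ 2 ≤ 2 * (I.biUnion (fun p => raySum A p.1 p.2)).card := by
      apply card_biUnion_ge
      · intro p hp
        simp only [hI, Finset.mem_filter, Finset.mem_product] at hp
        rw [card_raySum A hp.2.ne, sq]
        exact Nat.mul_le_mul (hS _ (hΛS hp.1.1)) (hS _ (hΛS hp.1.2))
      · intro p hp q hq hpq
        simp only [hI, Finset.mem_filter, Finset.mem_product] at hp hq
        have := hover p.1 (hΛS hp.1.1) p.2 (hΛS hp.1.2) q.1 (hΛS hq.1.1) q.2 (hΛS hq.1.2) hp.2 hq.2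
          hpq
        rw [← hIc] at this
        linarith
    set R := ((A + A) ×ˢ (A + A)).filter (fun z => ∃ i ∈ S, i * z.1 < z.2) with hR
    set R' := ((A + A) ×ˢ (A + A)).filter (fun z => ∃ i ∈ S \ Λ, i * z.1 < z.2) with hR'
    set V := I.biUnion (fun p => raySum A p.1 p.2) with hV
    have hdisj : Disjoint R' V := by
      rw [Finset.disjoint_left]
      intro z hz hz'
      simp only [hR', Finset.mem_filter] at hz
      obtain ⟨p, hp, hzp⟩ := Finset.mem_biUnion.1 hz'
      simp only [hI, Finset.mem_filter, Finset.mem_product] at hp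
      obtain ⟨hzA, i, hi, hlt⟩ := hz
      have h4 := (raySum_cone hA hp.2 hzp).2
      have h5 := hΛ p.2 hp.1.2 i hi
      obtain ⟨a, ha, b, hb, hab⟩ := Finset.mem_add.1 (Finset.mem_product.1 hzA).1
      have h6 : 0 < z.1 := by rw [← hab]; exact add_pos (hA a ha) (hA b hb)
      nlinarith
    have hsub : R' ∪ V ⊆ R := by
      apply Finset.union_subset
      · intro z hz
        simp only [hR', hR, Finset.mem_filter] at hz ⊢
        obtain ⟨hzA, i, hi, hlt⟩ := hz
        exact ⟨hzA, i, hsd hi, hlt⟩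
      · intro z hz
        obtain ⟨p, hp, hzp⟩ := Finset.mem_biUnion.1 hz
        simp only [hI, Finset.mem_filter, Finset.mem_product] at hp
        exact Finset.mem_filter.2 ⟨raySum_subset A _ _ hzp, p.1, hΛS hp.1.1,
          (raySum_cone hA hp.2 hzp).1⟩
    have h3 := Finset.card_le_card hsub
    rw [Finset.card_union_of_disjoint hdisj] at h3
    have h4 : (k + 1) * (m * (m - 1) * t ^ 2) = k * (m * (m - 1) * t ^ 2) + 2 * (I.card * t ^ 2) := by
      rw [← hIc]; ring
    omega

/-- An overlap between the sums from two different pairs of lines yields, after projecting along a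
direction `e` not shared by the pairs, additive relations `x + y ∈ Z` between dilates of rays. -/
theorem exists_relation_of_overlap {A : Finset ℝ} {e f k l : ℝ} (hek : e ≠ k)
    (hel : e ≠ l) (hef : e ≠ f) :
    ∃ Y Z : Finset ℝ, Y.card ≤ (ray A l).card ∧ Z.card ≤ (ray A f).card ∧
      (raySum A e f ∩ raySum A k l).card ≤ ∑ x ∈ ray A k, sumDegree Y Z x := by
  classical
  have h1 : k - e ≠ 0 := sub_ne_zero.2 hek.symm
  have h2 : l - e ≠ 0 := sub_ne_zero.2 hel.symm
  have h3 : f - e ≠ 0 := sub_ne_zero.2 hef.symm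
  refine ⟨(ray A l).image (fun y => (l - e) / (k - e) * y),
    (ray A f).image (fun y => (f - e) / (k - e) * y), Finset.card_image_le, Finset.card_image_le, ?_⟩
  set Y := (ray A l).image (fun y => (l - e) / (k - e) * y) with hY
  set Z := (ray A f).image (fun y => (f - e) / (k - e) * y) with hZ
  have h4 : ∑ x ∈ ray A k, sumDegree Y Z x =
      ((ray A k).sigma (fun x => Y.filter (fun y => x + y ∈ Z))).card :=
    (Finset.card_sigma _ _).symm
  rw [h4]
  refine le_trans (Finset.card_le_card ?_) (Finset.card_image_le (f := fun u : (_ : ℝ) × ℝ =>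
    (u.1 + (k - e) / (l - e) * u.2, k * u.1 + l * ((k - e) / (l - e) * u.2))))
  intro v hv
  simp only [raySum, Finset.mem_inter, Finset.mem_image, Finset.mem_product] at hv
  obtain ⟨⟨⟨xe, xf⟩, ⟨hxe, hxf⟩, rfl⟩, ⟨xk, xl⟩, ⟨hxk, hxl⟩, hv⟩ := hv
  simp only [Prod.mk.injEq] at hv
  refine Finset.mem_image.2 ⟨⟨xk, (l - e) / (k - e) * xl⟩, ?_, ?_⟩
  · refine Finset.mem_sigma.2 ⟨hxk, Finset.mem_filter.2 ⟨Finset.mem_image_of_mem _ hxl, ?_⟩⟩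
    refine Finset.mem_image.2 ⟨xf, hxf, ?_⟩
    field_simp
    linear_combination e * hv.1 - hv.2
  · have h5 : (k - e) / (l - e) * ((l - e) / (k - e) * xl) = xl := by
      field_simp
    simp only [h5]
    rw [hv.1, hv.2]

/-! ### The dichotomy for popular slopes -/

/-- `H` absorbs the products (or the quotients) of the rays of `A`: the ray of slope `i` has all its
products (quotients) in `{q ∈ H | i q ∈ H}`, recorded as the Cauchy–Schwarz inequality between the
size of this set and every weighted multiplicative energy of the ray. -/
def ControlsRays (A H : Finset ℝ) : Prop :=
  ∀ (i : ℝ) (w : ℝ → ℕ), (∑ x ∈ ray A i, w x) ^ 4 ≤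
    (H.filter (fun q => i * q ∈ H)).card * ∑ μ ∈ ray A i / ray A i, weightedRatioRep (ray A i) w μ ^ 2

theorem overlap_pow_four_le {A H : Finset ℝ} (hA : ∀ x ∈ A, 0 < x) (hH : ControlsRays A H)
    {t n : ℕ} (ht : 1 ≤ t) (htn : t ≤ n) {e f k l : ℝ} (hek : e ≠ k) (hel : e ≠ l) (hef : e ≠ f)
    (hf : (ray A f).card ≤ 2 * t) (hk : (ray A k).card ≤ 2 * t) (hl : (ray A l).card ≤ 2 * t) :
    (raySum A e f ∩ raySum A k l).card ^ 4 ≤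
      (H.filter (fun q => k * q ∈ H)).card * (640000 * (Nat.log 2 n + 1) * t ^ 6) := by
  obtain ⟨Y, Z, hY, hZ, h1⟩ := exists_relation_of_overlap (A := A) hek hel hef
  refine (Nat.pow_le_pow_left h1 4).trans ((hH k (sumDegree Y Z)).trans ?_)
  refine Nat.mul_le_mul_left _ ?_
  exact weighted_energy_le _ Y Z (fun x hx => hA x (Finset.mem_filter.1 hx).1) ht htn hk
    (hY.trans hl) (hZ.trans hf)

/-- Slopes `i` of rays of size about `t` for which few `q ∈ H` satisfy `i q ∈ H` have few
overlapping sums, so by the cluster argument there are few such slopes. -/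
theorem clusters_of_poor_slopes {A H : Finset ℝ} (hA : ∀ x ∈ A, 0 < x) (hH : ControlsRays A H)
    {t n m : ℕ} (ht : 1 ≤ t) (htn : t ≤ n) (S : Finset ℝ)
    (hS : ∀ i ∈ S, t ≤ (ray A i).card ∧ (ray A i).card ≤ 2 * t)
    (hpoor : ∀ i ∈ S, 40000 * (Nat.log 2 n + 1) * m ^ 8 *
      (H.filter (fun q => i * q ∈ H)).card ≤ t ^ 2)
    {k : ℕ} (hk : k * m ≤ S.card) :
    k * (m * (m - 1) * t ^ 2) ≤ 4 * (A + A).card ^ 2 := by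
  classical
  refine (clusters_le_card_sumset_sq hA k S (fun i hi => (hS i hi).1) ?_ hk).trans ?_
  swap
  · rw [sq, ← Finset.card_product]
    exact Nat.mul_le_mul_left _ (Finset.card_filter_le _ _)
  -- `e` is the direction along which the relation is projected; it must miss the second pair
  have main : ∀ e ∈ S, ∀ f ∈ S, ∀ k ∈ S, ∀ l ∈ S, e ≠ k → e ≠ l → e ≠ f →
      m * (m - 1) * (raySum A e f ∩ raySum A k l).card ≤ 2 * t ^ 2 := by
    intro e _ f hf k hk l hl hek hel hef
    have h1 := overlap_pow_four_le hA hH ht htn hek hel hef (hS f hf).2 (hS k hk).2 (hS l hl).2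
    have h2 := hpoor k hk
    set v := (raySum A e f ∩ raySum A k l).card
    set c := (H.filter (fun q => k * q ∈ H)).card
    set L := Nat.log 2 n + 1
    have h3 : (m ^ 2 * v) ^ 4 ≤ (2 * t ^ 2) ^ 4 := by
      calc (m ^ 2 * v) ^ 4 = m ^ 8 * v ^ 4 := by ring
        _ ≤ m ^ 8 * (c * (640000 * L * t ^ 6)) := Nat.mul_le_mul_left _ h1
        _ = 16 * (40000 * L * m ^ 8 * c) * t ^ 6 := by ring
        _ ≤ 16 * t ^ 2 * t ^ 6 := by gcongr
        _ = _ := by ring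
    have h4 := lt_of_pow_lt_pow_left₀ (n := 4) (a := m ^ 2 * v) (b := 2 * t ^ 2 + 1) (by omega)
      (h3.trans_lt (Nat.pow_lt_pow_left (Nat.lt_succ_self _) (by norm_num)))
    have h5 : m * (m - 1) ≤ m ^ 2 := by
      rw [sq]
      exact Nat.mul_le_mul_left _ (Nat.sub_le _ _)
    have h6 := Nat.mul_le_mul_right v h5
    omega
  intro i hi j hj k hk l hl hij hkl hne
  by_cases h1 : i ≠ k ∧ i ≠ l
  · exact main i hi j hj k hk l hl h1.1 h1.2 hij.ne
  · rw [raySum_comm A i j]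
    have h2 : j ≠ k ∧ j ≠ l := by
      constructor
      · rintro rfl
        apply h1
        exact ⟨hij.ne, (hij.trans hkl).ne⟩
      · rintro rfl
        apply h1
        refine ⟨?_, hij.ne⟩
        rintro rfl
        exact hne rfl
    exact main j hj i hi k hk l hl h2.1 h2.2 hij.ne'

theorem ray_card_eq_weightedRatioRep (A : Finset ℝ) (i : ℝ) :
    weightedRatioRep A (fun _ => 1) i = (ray A i).card := by
  classical
  rw [weightedRatioRep]
  simp only [mul_one, Finset.sum_const, smul_eq_mul]
  refine Finset.card_bij' (fun p _ => p.1) (fun x _ => (x, i * x)) ?_ ?_ ?_ ?_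
  · intro p hp
    simp only [Finset.mem_filter, Finset.mem_product] at hp
    rw [ray, Finset.mem_filter, ← hp.2]
    exact hp.1
  · intro x hx
    simpa [ray] using hx
  · intro p hp
    exact Prod.ext rfl (Finset.mem_filter.1 hp).2.symm
  · intro x _
    rfl

theorem ray_one (A : Finset ℝ) : ray A 1 = A := by
  simp [ray]

/-- Double counting of the points of `A × A` on lines with slopes in `S`. -/
theorem sum_card_ray (A S : Finset ℝ) :
    ∑ i ∈ S, (ray A i).card = ∑ b ∈ A, (S.filter (fun i => i * b ∈ A)).card := by
  have h := Finset.sum_card_bipartiteAbove_eq_sum_card_bipartiteBelow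
    (s := S) (t := A) (fun i b => i * b ∈ A)
  simp only [Finset.bipartiteAbove, Finset.bipartiteBelow] at h
  exact h

theorem sum_card_ray_le {A : Finset ℝ} (hA : ∀ x ∈ A, 0 < x) (S : Finset ℝ) :
    ∑ i ∈ S, (ray A i).card ≤ A.card ^ 2 := by
  rw [sum_card_ray, sq]
  refine Finset.sum_le_card_nsmul _ _ _ fun b hb => ?_
  apply Finset.card_le_card_of_injOn (fun i => i * b)
  · intro i hi
    exact (Finset.mem_filter.1 hi).2
  · intro i _ j _ h
    exact mul_right_cancel₀ (hA b hb).ne' h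

/-- A dyadic class of slopes carrying a logarithmic proportion of the multiplicative energy. -/
theorem exists_popular_slopes {A H : Finset ℝ} (hne : A.Nonempty) (hH : ControlsRays A H) :
    ∃ (t : ℕ) (S : Finset ℝ), 1 ≤ t ∧ t ≤ A.card ∧
      (∀ i ∈ S, t ≤ (ray A i).card ∧ (ray A i).card ≤ 2 * t) ∧
      A.card ^ 4 ≤ 4 * H.card * (Nat.log 2 A.card + 1) * (S.card * t ^ 2) := by
  classical
  have h1 := hH 1 (fun _ => 1)
  simp only [ray_one, Finset.sum_const, smul_eq_mul, mul_one, one_mul, Finset.filter_mem_eq_inter,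
    Finset.inter_self, ray_card_eq_weightedRatioRep] at h1
  have hle : ∀ i, (ray A i).card ≤ A.card := fun i => Finset.card_filter_le _ _
  have hm : ∀ i ∈ A / A, Nat.log 2 (ray A i).card ∈ Finset.range (Nat.log 2 A.card + 1) := by
    intro i _
    exact Finset.mem_range.2 (Nat.lt_succ_of_le (Nat.log_mono_right (hle i)))
  set L := Nat.log 2 A.card + 1 with hL
  rw [← Finset.sum_fiberwise_of_maps_to hm] at h1
  obtain ⟨j, hj, hmax⟩ := Finset.exists_max_image (Finset.range L)
    (fun j => ∑ i ∈ (A / A).filter (fun i => Nat.log 2 (ray A i).card = j), (ray A i).card ^ 2)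
    ⟨0, Finset.mem_range.2 (Nat.succ_pos _)⟩
  have h2 := Finset.sum_le_card_nsmul _ _ _ hmax
  rw [Finset.card_range, smul_eq_mul] at h2
  set S := ((A / A).filter (fun i => Nat.log 2 (ray A i).card = j)).filter
    (fun i => (ray A i).card ≠ 0) with hSdef
  have hS : ∀ i ∈ S, 2 ^ j ≤ (ray A i).card ∧ (ray A i).card ≤ 2 * 2 ^ j := by
    intro i hi
    simp only [hSdef, Finset.mem_filter] at hi
    have h2 := Nat.pow_log_le_self 2 hi.2
    have h3 := Nat.lt_pow_succ_log_self (b := 2) (by norm_num) (ray A i).card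
    rw [hi.1.2] at h2 h3
    rw [pow_succ'] at h3
    exact ⟨h2, h3.le⟩
  refine ⟨2 ^ j, S, Nat.one_le_two_pow, ?_, hS, ?_⟩
  · have := Finset.mem_range.1 hj
    exact Nat.pow_le_of_le_log (Finset.card_pos.2 hne).ne' (by omega)
  · have h3 : ∑ i ∈ (A / A).filter (fun i => Nat.log 2 (ray A i).card = j), (ray A i).card ^ 2 =
        ∑ i ∈ S, (ray A i).card ^ 2 :=
      (Finset.sum_filter_of_ne fun i _ h h0 => by simp [h0] at h).symm
    have h4 : ∑ i ∈ S, (ray A i).card ^ 2 ≤ S.card * (4 * (2 ^ j) ^ 2) := by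
      refine Finset.sum_le_card_nsmul _ _ _ fun i hi => ?_
      calc (ray A i).card ^ 2 ≤ (2 * 2 ^ j) ^ 2 := Nat.pow_le_pow_left (hS i hi).2 2
        _ = _ := by ring
    rw [h3] at h2
    calc A.card ^ 4 ≤ _ := h1
      _ ≤ H.card * (L * (S.card * (4 * (2 ^ j) ^ 2))) := by gcongr; exact h2.trans (by gcongr)
      _ = _ := by ring

/-- Slopes `i` for which many `q ∈ H` satisfy `i q ∈ H` make up a dilate of a subset of `A`, to
which the bound for sums of sets with few products applies. -/
theorem rich_slopes_le {A H : Finset ℝ} (hA : ∀ x ∈ A, 0 < x) (hne : A.Nonempty)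
    (hHpos : ∀ q ∈ H, 0 < q) (hAH : A.card ≤ H.card) {t h : ℕ} (hh : 1 ≤ h) (S : Finset ℝ)
    (hS : ∀ i ∈ S, t ≤ (ray A i).card)
    (hrich : ∀ i ∈ S, h ≤ (H.filter (fun q => i * q ∈ H)).card) :
    (h : ℝ) ^ 15 * (S.card * t : ℝ) ^ 19 ≤
      256 ^ 5 * (A.card : ℝ) ^ 19 * ((Nat.log 2 A.card + 1 : ℕ) : ℝ) ^ 4 * (H.card : ℝ) ^ 20 *
        ((A + A).card : ℝ) ^ 9 := by
  classical
  have h1 : S.card * t ≤ ∑ b ∈ A, (S.filter (fun i => i * b ∈ A)).card := by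
    rw [← sum_card_ray]
    exact Finset.card_nsmul_le_sum _ _ _ hS
  obtain ⟨b, hb, hmax⟩ := Finset.exists_max_image A
    (fun b => (S.filter (fun i => i * b ∈ A)).card) hne
  have h2 := Finset.sum_le_card_nsmul _ _ _ hmax
  rw [smul_eq_mul] at h2
  set B := S.filter (fun i => i * b ∈ A) with hB
  have hb0 := (hA b hb).ne'
  have hBA : B.card ≤ A.card := by
    apply Finset.card_le_card_of_injOn (fun i => i * b)
    · intro i hi
      exact (Finset.mem_filter.1 hi).2
    · intro i _ j _ h
      exact mul_right_cancel₀ hb0 h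
  have hBB : (B + B).card ≤ (A + A).card := by
    apply Finset.card_le_card_of_injOn (fun i => i * b)
    · intro i hi
      obtain ⟨x, hx, y, hy, rfl⟩ := Finset.mem_add.1 hi
      show (x + y) * b ∈ _
      rw [add_mul]
      exact Finset.add_mem_add (Finset.mem_filter.1 hx).2 (Finset.mem_filter.1 hy).2
    · intro i _ j _ h
      exact mul_right_cancel₀ hb0 h
  have h3 := card_pow_le_of_quotient_reps B H hHpos hh
    (fun i hi => hrich i (Finset.mem_filter.1 hi).1) (hBA.trans hAH) hBA
  have h4 : (S.card * t : ℝ) ≤ A.card * B.card := by exact_mod_cast h1.trans h2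
  have h5 : ((B + B).card : ℝ) ≤ (A + A).card := by exact_mod_cast hBB
  calc (h : ℝ) ^ 15 * (S.card * t : ℝ) ^ 19 ≤ (h : ℝ) ^ 15 * (A.card * B.card : ℝ) ^ 19 := by gcongr
    _ = (A.card : ℝ) ^ 19 * ((h : ℝ) ^ 15 * (B.card : ℝ) ^ 19) := by ring
    _ ≤ (A.card : ℝ) ^ 19 * (256 ^ 5 * ((Nat.log 2 A.card + 1 : ℕ) : ℝ) ^ 4 * (H.card : ℝ) ^ 20 *
        ((B + B).card : ℝ) ^ 9) := by gcongr
    _ ≤ (A.card : ℝ) ^ 19 * (256 ^ 5 * ((Nat.log 2 A.card + 1 : ℕ) : ℝ) ^ 4 * (H.card : ℝ) ^ 20 *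
        ((A + A).card : ℝ) ^ 9) := by gcongr
    _ = _ := by ring

/-- The arithmetic that combines the popular class, the size of the clusters and the bound for
rich slopes. -/
theorem combine_bounds {n M L s t m h : ℝ} (hn : 0 < n) (hM : 0 ≤ M) (hL : 0 ≤ L) (hs : 0 ≤ s)
    (ht : 0 ≤ t) (hm : 0 ≤ m) (hh : 0 ≤ h) (h1 : n ^ 4 ≤ 4 * M * L * (s * t ^ 2))
    (h2 : s * t ≤ n ^ 2) (h3 : m * n ^ 4 ≤ 130 * M ^ 3 * L) (h4 : t ^ 2 ≤ 40000 * L * m ^ 8 * h)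
    (h5 : h ^ 15 * (s * t) ^ 19 ≤ 2 ^ 19 * 256 ^ 5 * n ^ 19 * L ^ 4 * M ^ 29) :
    n ^ 559 ≤ 4 ^ 30 * 40000 ^ 15 * 2 ^ 19 * 256 ^ 5 * 130 ^ 120 * L ^ 169 * M ^ 419 := by
  have k1 : n ^ 2 ≤ 4 * M * L * t := by
    refine le_of_mul_le_mul_left ?_ (pow_pos hn 2)
    calc n ^ 2 * n ^ 2 = n ^ 4 := by ring
      _ ≤ 4 * M * L * (s * t ^ 2) := h1
      _ = 4 * M * L * t * (s * t) := by ring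
      _ ≤ 4 * M * L * t * n ^ 2 := by gcongr
      _ = _ := by ring
  have k2 : n ^ 98 ≤ (4 * M * L) ^ 30 * ((t ^ 2) ^ 15 * (s * t) ^ 19) := by
    calc n ^ 98 = (n ^ 2) ^ 11 * (n ^ 4) ^ 19 := by ring
      _ ≤ (4 * M * L * t) ^ 11 * (4 * M * L * (s * t ^ 2)) ^ 19 := by gcongr
      _ = _ := by ring
  have k3 : (t ^ 2) ^ 15 * (s * t) ^ 19 ≤ (40000 * L * m ^ 8) ^ 15 *
      (2 ^ 19 * 256 ^ 5 * n ^ 19 * L ^ 4 * M ^ 29) := by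
    calc (t ^ 2) ^ 15 * (s * t) ^ 19 ≤ (40000 * L * m ^ 8 * h) ^ 15 * (s * t) ^ 19 := by gcongr
      _ = (40000 * L * m ^ 8) ^ 15 * (h ^ 15 * (s * t) ^ 19) := by ring
      _ ≤ _ := by gcongr
  have k4 : n ^ 79 ≤ 4 ^ 30 * 40000 ^ 15 * 2 ^ 19 * 256 ^ 5 * L ^ 49 * M ^ 59 * m ^ 120 := by
    refine le_of_mul_le_mul_left ?_ (pow_pos hn 19)
    calc n ^ 19 * n ^ 79 = n ^ 98 := by ring
      _ ≤ _ := k2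
      _ ≤ (4 * M * L) ^ 30 * ((40000 * L * m ^ 8) ^ 15 *
          (2 ^ 19 * 256 ^ 5 * n ^ 19 * L ^ 4 * M ^ 29)) := by gcongr
      _ = _ := by ring
  calc n ^ 559 = n ^ 79 * (n ^ 4) ^ 120 := by ring
    _ ≤ (4 ^ 30 * 40000 ^ 15 * 2 ^ 19 * 256 ^ 5 * L ^ 49 * M ^ 59 * m ^ 120) * (n ^ 4) ^ 120 := by
        gcongr
    _ = 4 ^ 30 * 40000 ^ 15 * 2 ^ 19 * 256 ^ 5 * L ^ 49 * M ^ 59 * (m * n ^ 4) ^ 120 := by ring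
    _ ≤ 4 ^ 30 * 40000 ^ 15 * 2 ^ 19 * 256 ^ 5 * L ^ 49 * M ^ 59 * (130 * M ^ 3 * L) ^ 120 := by
        gcongr
    _ = _ := by ring

/-- A constant for which the sum-product bound below holds. -/
noncomputable def sumProductConst : ℝ := 4 ^ 30 * 40000 ^ 15 * 2 ^ 19 * 256 ^ 5 * 130 ^ 120

/-- The sum-product bound `|A|^(559/419) ≲ max (|A + A|, |H|)`, with `H = AA` or `H = A / A`, for sets
of positive reals. The assumption `|A|⁴ ≤ M³` costs nothing, as `M` may be enlarged to `|A|^(4/3)`. -/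
theorem card_pow_le_sumProduct {A H : Finset ℝ} (hA : ∀ x ∈ A, 0 < x) (hne : A.Nonempty)
    (hHpos : ∀ q ∈ H, 0 < q) (hH : ControlsRays A H) (hAH : A.card ≤ H.card) {M : ℕ}
    (hAM : (A + A).card ≤ M) (hHM : H.card ≤ M) (hM : A.card ^ 4 ≤ M ^ 3) :
    (A.card : ℝ) ^ 559 ≤
      sumProductConst * ((Nat.log 2 A.card + 1 : ℕ) : ℝ) ^ 186 * (M : ℝ) ^ 419 := by
  classical
  obtain ⟨t, S, ht, htn, hS, hE⟩ := exists_popular_slopes hne hH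
  have hn : 1 ≤ A.card := hne.card_pos
  have hnM : A.card ≤ M := hAH.trans hHM
  have hst : S.card * t ≤ A.card ^ 2 :=
    (Finset.card_nsmul_le_sum _ _ _ fun i hi => (hS i hi).1).trans (sum_card_ray_le hA S)
  have hE' : A.card ^ 4 ≤ 4 * M * (Nat.log 2 A.card + 1) * (S.card * t ^ 2) :=
    hE.trans (by gcongr)
  have hL : 1 ≤ Nat.log 2 A.card + 1 := Nat.succ_pos _
  have hrichle := @rich_slopes_le A H hA hne hHpos hAH t
  have hpoorle := fun m => @clusters_of_poor_slopes A H hA hH t A.card m ht htn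
  generalize Nat.log 2 A.card + 1 = L at *
  have hn4 : 0 < A.card ^ 4 := by positivity
  -- the size `m` of the clusters makes their sums exceed `M²` if most slopes are poor
  obtain ⟨m, hm2, hm3, hm1⟩ : ∃ m : ℕ, 2 ≤ m ∧ m * A.card ^ 4 ≤ 130 * M ^ 3 * L ∧
      128 * M ^ 3 * L < (m - 1) * A.card ^ 4 := by
    refine ⟨128 * M ^ 3 * L / A.card ^ 4 + 2, Nat.le_add_left _ _, ?_, ?_⟩
    · have h1 := Nat.div_mul_le_self (128 * M ^ 3 * L) (A.card ^ 4)
      have h2 : M ^ 3 * 1 ≤ M ^ 3 * L := Nat.mul_le_mul_left _ hL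
      rw [add_mul]
      linarith
    · have h1 := Nat.lt_mul_div_succ (128 * M ^ 3 * L) hn4
      rw [mul_comm (A.card ^ 4)] at h1
      exact h1
  set poor := S.filter (fun i =>
    40000 * L * m ^ 8 * (H.filter (fun q => i * q ∈ H)).card ≤ t ^ 2) with hpoor
  set rich := S.filter (fun i =>
    ¬ 40000 * L * m ^ 8 * (H.filter (fun q => i * q ∈ H)).card ≤ t ^ 2) with hrich
  have hsum : poor.card + rich.card = S.card := Finset.card_filter_add_card_filter_not _
  have hn' : (1 : ℝ) ≤ A.card := by exact_mod_cast hn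
  have hL' : (1 : ℝ) ≤ L := by exact_mod_cast hL
  have hM' : (1 : ℝ) ≤ M := by exact_mod_cast hn.trans hnM
  rcases le_or_gt S.card (2 * rich.card) with hc | hc
  · have hD : 0 < 40000 * L * m ^ 8 := by positivity
    set h := t ^ 2 / (40000 * L * m ^ 8) + 1 with hh
    have h1 := hrichle (h := h) (Nat.le_add_left _ _) rich (fun i hi => (hS i (Finset.mem_filter.1 hi).1).1)
      (fun i hi => Nat.div_lt_of_lt_mul (not_le.1 (Finset.mem_filter.1 hi).2))
    have h2 : t ^ 2 ≤ 40000 * L * m ^ 8 * h := (Nat.lt_mul_div_succ _ hD).le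
    have hc' : (S.card : ℝ) ≤ 2 * rich.card := by exact_mod_cast hc
    have h3 : (h : ℝ) ^ 15 * (S.card * t : ℝ) ^ 19 ≤
        2 ^ 19 * 256 ^ 5 * (A.card : ℝ) ^ 19 * (L : ℝ) ^ 4 * (M : ℝ) ^ 29 := by
      calc (h : ℝ) ^ 15 * (S.card * t : ℝ) ^ 19 ≤ (h : ℝ) ^ 15 * (2 * rich.card * t : ℝ) ^ 19 := by
            gcongr
        _ = 2 ^ 19 * ((h : ℝ) ^ 15 * (rich.card * t : ℝ) ^ 19) := by ring
        _ ≤ 2 ^ 19 * (256 ^ 5 * (A.card : ℝ) ^ 19 * (L : ℝ) ^ 4 * (H.card : ℝ) ^ 20 *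
            ((A + A).card : ℝ) ^ 9) := by gcongr
        _ ≤ 2 ^ 19 * (256 ^ 5 * (A.card : ℝ) ^ 19 * (L : ℝ) ^ 4 * (M : ℝ) ^ 20 *
            (M : ℝ) ^ 9) := by gcongr
        _ = _ := by ring
    have h4 := combine_bounds (n := A.card) (M := M) (L := L) (s := S.card) (t := t) (m := m)
      (h := h) (by linarith) (by positivity) (by positivity) (by positivity) (by positivity)
      (by positivity) (by positivity) (by exact_mod_cast hE') (by exact_mod_cast hst)
      (by exact_mod_cast hm3) (by exact_mod_cast h2) h3
    rw [sumProductConst]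
    refine h4.trans ?_
    gcongr; norm_num
  · rcases le_or_gt m poor.card with hm | hm
    · exfalso
      have h1 := Nat.div_mul_le_self poor.card m
      have h2 := Nat.lt_div_mul_add (a := poor.card) (b := m) (by omega)
      have h3 := hpoorle m poor (fun i hi => hS i (Finset.mem_filter.1 hi).1)
        (fun i hi => (Finset.mem_filter.1 hi).2) h1
      have h4 : m * 1 ≤ m * (poor.card / m) :=
        Nat.mul_le_mul_left _ ((Nat.one_le_div_iff (by omega)).2 hm)
      generalize poor.card / m = k at *
      have h5 : S.card ≤ 4 * (k * m) := by
        rw [mul_comm k m] at h2 ⊢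
        omega
      have h6 : (m - 1) * A.card ^ 4 ≤ 64 * M ^ 3 * L := by
        calc (m - 1) * A.card ^ 4 ≤ (m - 1) * (4 * M * L * (S.card * t ^ 2)) := by gcongr
          _ ≤ (m - 1) * (4 * M * L * (4 * (k * m) * t ^ 2)) := by gcongr
          _ = 16 * M * L * (k * (m * (m - 1) * t ^ 2)) := by ring
          _ ≤ 16 * M * L * (4 * (A + A).card ^ 2) := by gcongr
          _ ≤ 16 * M * L * (4 * M ^ 2) := by gcongr
          _ = _ := by ring
      have h7 : 128 * M ^ 3 * L = 64 * M ^ 3 * L + 64 * M ^ 3 * L := by ring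
      omega
    -- no full cluster exists: then `S` is so small that `M` is at least about `n^(3/2)`
    · have h1 : A.card ^ 6 ≤ 1040 * M ^ 4 * L ^ 2 := by
        have h2 : S.card ≤ 2 * m := by omega
        have hn2 : 0 < A.card ^ 2 := by positivity
        refine Nat.le_of_mul_le_mul_right ?_ hn2
        calc A.card ^ 6 * A.card ^ 2 = A.card ^ 4 * A.card ^ 4 := by ring
          _ ≤ (4 * M * L * (S.card * t ^ 2)) * A.card ^ 4 := by gcongr
          _ ≤ (4 * M * L * (2 * m * A.card ^ 2)) * A.card ^ 4 := by gcongr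
          _ = 8 * M * L * A.card ^ 2 * (m * A.card ^ 4) := by ring
          _ ≤ 8 * M * L * A.card ^ 2 * (130 * M ^ 3 * L) := by gcongr
          _ = _ := by ring
      have h1' : (A.card : ℝ) ^ 6 ≤ 1040 * (M : ℝ) ^ 4 * (L : ℝ) ^ 2 := by exact_mod_cast h1
      have hnM' : (A.card : ℝ) ≤ M := by exact_mod_cast hnM
      calc (A.card : ℝ) ^ 559 = ((A.card : ℝ) ^ 6) ^ 93 * A.card := by ring
        _ ≤ (1040 * (M : ℝ) ^ 4 * (L : ℝ) ^ 2) ^ 93 * M := by gcongr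
        _ = 1040 ^ 93 * (L : ℝ) ^ 186 * (M : ℝ) ^ 373 := by ring
        _ ≤ sumProductConst * (L : ℝ) ^ 186 * (M : ℝ) ^ 419 := by
          rw [sumProductConst]
          gcongr <;> first | exact hM' | norm_num

/-! ### Products, quotients and the final exponent -/

theorem sum_fiber_weight_sq {α β : Type*} [DecidableEq β] (T : Finset α) (K : Finset β)
    (f : α → β) (hf : ∀ t ∈ T, f t ∈ K) (v : α → ℕ) :
    ∑ k ∈ K, (∑ t ∈ T.filter (fun t => f t = k), v t) ^ 2 =
      ∑ x ∈ (T ×ˢ T).filter (fun x => f x.1 = f x.2), v x.1 * v x.2 := by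
  classical
  have hm : ∀ x ∈ (T ×ˢ T).filter (fun x => f x.1 = f x.2), f x.1 ∈ K := fun x hx =>
    hf _ (Finset.mem_product.1 (Finset.mem_filter.1 hx).1).1
  rw [← Finset.sum_fiberwise_of_maps_to hm]
  refine Finset.sum_congr rfl fun k _ => ?_
  rw [sq, Finset.sum_mul_sum, ← Finset.sum_product']
  refine Finset.sum_congr ?_ fun _ _ => rfl
  ext x
  simp only [Finset.mem_product, Finset.mem_filter]
  constructor
  · rintro ⟨⟨h1, h2⟩, h3, h4⟩
    exact ⟨⟨⟨h1, h3⟩, h2.trans h4.symm⟩, h2⟩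
  · rintro ⟨⟨⟨h1, h3⟩, h⟩, h2⟩
    exact ⟨⟨h1, h2⟩, h3, h.symm.trans h2⟩

theorem weightedRatioRep_eq {X : Finset ℝ} (hX : ∀ x ∈ X, 0 < x) (w : ℝ → ℕ) (μ : ℝ) :
    weightedRatioRep X w μ =
      ∑ p ∈ (X ×ˢ X).filter (fun p => p.2 / p.1 = μ), w p.1 * w p.2 := by
  rw [weightedRatioRep]
  refine Finset.sum_congr (Finset.filter_congr fun p hp => ?_) fun _ _ => rfl
  rw [div_eq_iff (hX _ (Finset.mem_product.1 hp).1).ne']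

theorem sum_pow_four_le_div {X : Finset ℝ} (hX : ∀ x ∈ X, 0 < x) (w : ℝ → ℕ) :
    (∑ x ∈ X, w x) ^ 4 ≤ (X / X).card * ∑ μ ∈ X / X, weightedRatioRep X w μ ^ 2 := by
  classical
  have hm : ∀ p ∈ X ×ˢ X, p.2 / p.1 ∈ X / X := fun p hp =>
    Finset.div_mem_div (Finset.mem_product.1 hp).2 (Finset.mem_product.1 hp).1
  have h1 : (∑ x ∈ X, w x) ^ 2 = ∑ μ ∈ X / X, weightedRatioRep X w μ := by
    simp only [weightedRatioRep_eq hX]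
    rw [Finset.sum_fiberwise_of_maps_to hm, Finset.sum_product, sq, Finset.sum_mul_sum]
  calc (∑ x ∈ X, w x) ^ 4 = ((∑ x ∈ X, w x) ^ 2) ^ 2 := by ring
    _ ≤ _ := by
      rw [h1]
      exact sq_sum_le_card_mul_sum_sq

theorem sum_pow_four_le_mul {X : Finset ℝ} (hX : ∀ x ∈ X, 0 < x) (w : ℝ → ℕ) :
    (∑ x ∈ X, w x) ^ 4 ≤ (X * X).card * ∑ μ ∈ X / X, weightedRatioRep X w μ ^ 2 := by
  classical
  have hm : ∀ p ∈ X ×ˢ X, p.1 * p.2 ∈ X * X := fun p hp =>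
    Finset.mul_mem_mul (Finset.mem_product.1 hp).1 (Finset.mem_product.1 hp).2
  have hd : ∀ p ∈ X ×ˢ X, p.2 / p.1 ∈ X / X := fun p hp =>
    Finset.div_mem_div (Finset.mem_product.1 hp).2 (Finset.mem_product.1 hp).1
  have h1 : (∑ x ∈ X, w x) ^ 2 = ∑ q ∈ X * X,
      ∑ p ∈ (X ×ˢ X).filter (fun p => p.1 * p.2 = q), w p.1 * w p.2 := by
    rw [Finset.sum_fiberwise_of_maps_to hm, Finset.sum_product, sq, Finset.sum_mul_sum]
  -- `a b = c d` amounts to `a / c = d / b`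
  have h2 : ∑ q ∈ X * X, (∑ p ∈ (X ×ˢ X).filter (fun p => p.1 * p.2 = q), w p.1 * w p.2) ^ 2 =
      ∑ μ ∈ X / X, weightedRatioRep X w μ ^ 2 := by
    simp only [weightedRatioRep_eq hX]
    rw [sum_fiber_weight_sq _ _ _ hm (fun p => w p.1 * w p.2),
      sum_fiber_weight_sq _ _ _ hd (fun p => w p.1 * w p.2)]
    refine Finset.sum_bij' (fun x _ => ((x.2.1, x.1.1), (x.1.2, x.2.2)))
      (fun x _ => ((x.1.2, x.2.1), (x.1.1, x.2.2))) ?_ ?_ ?_ ?_ ?_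
    · intro x hx
      simp only [Finset.mem_filter, Finset.mem_product] at hx ⊢
      obtain ⟨⟨⟨ha, hb⟩, hc, hd⟩, h⟩ := hx
      refine ⟨⟨⟨hc, ha⟩, hb, hd⟩, ?_⟩
      rw [div_eq_div_iff (hX _ hc).ne' (hX _ hb).ne', h, mul_comm]
    · intro x hx
      simp only [Finset.mem_filter, Finset.mem_product] at hx ⊢
      obtain ⟨⟨⟨hc, ha⟩, hb, hd⟩, h⟩ := hx
      refine ⟨⟨⟨ha, hb⟩, hc, hd⟩, ?_⟩
      rw [div_eq_div_iff (hX _ hc).ne' (hX _ hb).ne'] at h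
      rw [h, mul_comm]
    · intro x _
      rfl
    · intro x _
      rfl
    · intro x _
      ring
  calc (∑ x ∈ X, w x) ^ 4 = ((∑ x ∈ X, w x) ^ 2) ^ 2 := by ring
    _ ≤ _ := by
      rw [h1, ← h2]
      exact sq_sum_le_card_mul_sum_sq

theorem controlsRays_mul {A : Finset ℝ} (hA : ∀ x ∈ A, 0 < x) : ControlsRays A (A * A) := by
  classical
  intro i w
  refine (sum_pow_four_le_mul (fun x hx => hA x (Finset.mem_filter.1 hx).1) w).trans
    (Nat.mul_le_mul_right _ (Finset.card_le_card fun q hq => ?_))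
  obtain ⟨x, hx, y, hy, rfl⟩ := Finset.mem_mul.1 hq
  have hx' := Finset.mem_filter.1 hx
  have hy' := (Finset.mem_filter.1 hy).1
  rw [Finset.mem_filter, ← mul_assoc]
  exact ⟨Finset.mul_mem_mul hx'.1 hy', Finset.mul_mem_mul hx'.2 hy'⟩

theorem controlsRays_div {A : Finset ℝ} (hA : ∀ x ∈ A, 0 < x) : ControlsRays A (A / A) := by
  classical
  intro i w
  refine (sum_pow_four_le_div (fun x hx => hA x (Finset.mem_filter.1 hx).1) w).trans
    (Nat.mul_le_mul_right _ (Finset.card_le_card fun q hq => ?_))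
  obtain ⟨x, hx, y, hy, rfl⟩ := Finset.mem_div.1 hq
  have hx' := Finset.mem_filter.1 hx
  have hy' := (Finset.mem_filter.1 hy).1
  rw [Finset.mem_filter, ← mul_div_assoc]
  exact ⟨Finset.div_mem_div hx'.1 hy', Finset.div_mem_div hx'.2 hy'⟩

/-- A set of reals contains, up to sign, at least a quarter of its elements in a set of positive
reals, whose sums, products and quotients are no more numerous. -/
theorem exists_positive_part (A : Finset ℝ) (hA : 2 ≤ A.card) :
    ∃ P : Finset ℝ, (∀ x ∈ P, 0 < x) ∧ P.Nonempty ∧ A.card ≤ 4 * P.card ∧ P.card ≤ A.card ∧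
      (P + P).card ≤ (A + A).card ∧ (P * P).card ≤ (A * A).card ∧
      (P / P).card ≤ (quotientSet A A).card := by
  classical
  have hpos : A.card ≤ (A.filter (fun x => 0 < x)).card + (A.filter (fun x => x < 0)).card + 1 := by
    have h1 : A ⊆ (A.filter (fun x => 0 < x) ∪ A.filter (fun x => x < 0)) ∪ {0} := by
      intro x hx
      rcases lt_trichotomy x 0 with h | h | h <;> simp [hx, h]
    refine (Finset.card_le_card h1).trans ((Finset.card_union_le _ _).trans ?_)
    rw [Finset.card_singleton]
    exact Nat.add_le_add_right (Finset.card_union_le _ _) 1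
  have hquot : ∀ B ⊆ A, (∀ x ∈ B, x ≠ 0) → B / B ⊆ quotientSet A A := fun B hB h0 =>
    Finset.div_subset_div hB fun x hx => Finset.mem_erase.2 ⟨h0 x hx, hB hx⟩
  rcases le_total (A.filter (fun x => x < 0)).card (A.filter (fun x => 0 < x)).card with h | h
  · refine ⟨A.filter (fun x => 0 < x), fun x hx => (Finset.mem_filter.1 hx).2, ?_, by omega,
      Finset.card_filter_le _ _, ?_, ?_, ?_⟩
    · rw [← Finset.card_pos]; omega
    · exact Finset.card_le_card
        (Finset.add_subset_add (Finset.filter_subset _ _) (Finset.filter_subset _ _))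
    · exact Finset.card_le_card
        (Finset.mul_subset_mul (Finset.filter_subset _ _) (Finset.filter_subset _ _))
    · exact Finset.card_le_card (hquot _ (Finset.filter_subset _ _)
        fun x hx => (Finset.mem_filter.1 hx).2.ne')
  · set B := A.filter (fun x => x < 0) with hB
    have hBA : B ⊆ A := Finset.filter_subset _ _
    have hB0 : ∀ x ∈ B, x < 0 := fun x hx => (Finset.mem_filter.1 hx).2
    refine ⟨-B, ?_, ?_, ?_, ?_, ?_, ?_, ?_⟩
    · intro x hx
      have := hB0 _ (Finset.mem_neg'.1 hx)
      linarith
    · rw [← Finset.card_pos, Finset.card_neg]; omega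
    · rw [Finset.card_neg]; omega
    · rw [Finset.card_neg]; exact Finset.card_le_card hBA
    · rw [← neg_add, Finset.card_neg]
      exact Finset.card_le_card (Finset.add_subset_add hBA hBA)
    · rw [neg_mul_neg]
      exact Finset.card_le_card (Finset.mul_subset_mul hBA hBA)
    · refine Finset.card_le_card (fun q hq => hquot B hBA (fun x hx => (hB0 x hx).ne) ?_)
      obtain ⟨x, hx, y, hy, rfl⟩ := Finset.mem_div.1 hq
      have h2 := Finset.div_mem_div (Finset.mem_neg'.1 hx) (Finset.mem_neg'.1 hy)
      rwa [neg_div_neg_eq] at h2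

theorem one_le_sumProductConst : 1 ≤ sumProductConst := by
  rw [sumProductConst]
  norm_num

/-- The bound `card_pow_le_sumProduct` as a real power, with `|A|^(4/3)` added on the right. -/
theorem rpow_card_le {A H : Finset ℝ} (hA : ∀ x ∈ A, 0 < x) (hne : A.Nonempty)
    (hHpos : ∀ q ∈ H, 0 < q) (hH : ControlsRays A H) (hAH : A.card ≤ H.card) :
    (A.card : ℝ) ^ (559 / 419 : ℝ) ≤ sumProductConst * ((Nat.log 2 A.card + 1 : ℕ) : ℝ) *
      ((max (A + A).card H.card + ⌈(A.card : ℝ) ^ (4 / 3 : ℝ)⌉₊ : ℕ) : ℝ) := by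
  set M := max (A + A).card H.card + ⌈(A.card : ℝ) ^ (4 / 3 : ℝ)⌉₊ with hM
  have hn : (0 : ℝ) ≤ A.card := Nat.cast_nonneg _
  have h1 : A.card ^ 4 ≤ M ^ 3 := by
    have h2 : (A.card : ℝ) ^ (4 / 3 : ℝ) ≤ M := by
      refine (Nat.le_ceil _).trans ?_
      rw [hM]
      exact_mod_cast Nat.le_add_left _ _
    have h3 : ((A.card : ℝ) ^ (4 / 3 : ℝ)) ^ 3 = (A.card : ℝ) ^ 4 := by
      rw [← Real.rpow_natCast, ← Real.rpow_mul hn, ← Real.rpow_natCast]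
      norm_num
    have h4 : (A.card : ℝ) ^ 4 ≤ (M : ℝ) ^ 3 := by
      rw [← h3]
      gcongr
    exact_mod_cast h4
  have h2 := card_pow_le_sumProduct hA hne hHpos hH hAH (M := M)
    ((le_max_left _ _).trans (Nat.le_add_right _ _))
    ((le_max_right _ _).trans (Nat.le_add_right _ _)) h1
  set L : ℝ := ((Nat.log 2 A.card + 1 : ℕ) : ℝ) with hL
  have hL1 : 1 ≤ L := by
    rw [hL]
    exact_mod_cast Nat.succ_pos _
  have hC := one_le_sumProductConst
  have h3 : (A.card : ℝ) ^ 559 ≤ (sumProductConst * L * M) ^ 419 := by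
    refine h2.trans ?_
    rw [mul_pow, mul_pow]
    gcongr
    · exact le_self_pow₀ hC (by norm_num)
    · norm_num
  have h4 : (A.card : ℝ) ^ (559 / 419 : ℝ) = ((A.card : ℝ) ^ 559) ^ (1 / 419 : ℝ) := by
    rw [← Real.rpow_natCast, ← Real.rpow_mul hn]
    norm_num
  have h5 : sumProductConst * L * M = ((sumProductConst * L * M) ^ 419) ^ (1 / 419 : ℝ) := by
    rw [← Real.rpow_natCast, ← Real.rpow_mul (by positivity)]
    norm_num
  rw [h4, h5]
  gcongr

/-- As `559 / 419 > 4 / 3 + 5 / 9813 > 4 / 3`, the logarithm and the term `n^(4/3)` are absorbed for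
large `n`. -/
theorem exists_const_of_rpow_le {K : ℝ} (hK : 1 ≤ K) :
    ∃ C : ℝ, 0 < C ∧ ∀ n k m : ℕ, 2 ≤ n → n ≤ 4 * k → k ≤ n → 1 ≤ m →
      (k : ℝ) ^ (559 / 419 : ℝ) ≤ K * ((Nat.log 2 k + 1 : ℕ) : ℝ) *
        ((m + ⌈(k : ℝ) ^ (4 / 3 : ℝ)⌉₊ : ℕ) : ℝ) →
      (n : ℝ) ^ ((4 / 3 : ℝ) + 5 / 9813) ≤ C * (m : ℝ) * Real.log n ^ (1 : ℝ) := by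
  have hlo := (isLittleO_log_rpow_atTop (r := (1 / 1257 : ℝ)) (by norm_num)).bound
    (c := 1 / (192 * K)) (by positivity)
  obtain ⟨N, hN⟩ := Filter.eventually_atTop.1 (tendsto_natCast_atTop_atTop.eventually hlo)
  refine ⟨96 * K + 2 * (N : ℝ) ^ 2, by positivity, ?_⟩
  intro n k m hn hnk hkn hm h
  have hn' : (2 : ℝ) ≤ n := by exact_mod_cast hn
  have hm' : (1 : ℝ) ≤ m := by exact_mod_cast hm
  have hlog2 : (0.69 : ℝ) < Real.log 2 := by
    have := Real.log_two_gt_d9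
    linarith
  have hlog : Real.log 2 ≤ Real.log n := Real.log_le_log (by norm_num) hn'
  rw [Real.rpow_one]
  rcases lt_or_ge n N with hnN | hnN
  · have h1 : (n : ℝ) ^ ((4 / 3 : ℝ) + 5 / 9813) ≤ (N : ℝ) ^ 2 := by
      calc (n : ℝ) ^ ((4 / 3 : ℝ) + 5 / 9813) ≤ (n : ℝ) ^ (2 : ℝ) :=
            Real.rpow_le_rpow_of_exponent_le (by linarith) (by norm_num)
        _ = (n : ℝ) ^ 2 := by norm_cast
        _ ≤ (N : ℝ) ^ 2 := by gcongr
    calc (n : ℝ) ^ ((4 / 3 : ℝ) + 5 / 9813) ≤ (N : ℝ) ^ 2 * 1 * 1 := by linarith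
      _ ≤ (N : ℝ) ^ 2 * m * (2 * Real.log n) := by gcongr; linarith
      _ = 0 + 2 * (N : ℝ) ^ 2 * m * Real.log n := by ring
      _ ≤ 96 * K * m * Real.log n + 2 * (N : ℝ) ^ 2 * m * Real.log n := by
          gcongr
          have : 0 ≤ Real.log n := by linarith
          positivity
      _ = _ := by ring
  · have hlogpos : 0 < Real.log n := by linarith
    have hL : ((Nat.log 2 k + 1 : ℕ) : ℝ) ≤ 3 * Real.log n := by
      have h1 : ((2 ^ Nat.log 2 n : ℕ) : ℝ) ≤ n := by
        exact_mod_cast Nat.pow_log_le_self 2 (by omega)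
      have h2 := Real.log_le_log (by positivity) h1
      push_cast at h2
      rw [Real.log_pow] at h2
      have h3 : ((Nat.log 2 k : ℕ) : ℝ) ≤ Nat.log 2 n := by
        exact_mod_cast Nat.log_mono_right hkn
      have h4 : (0 : ℝ) ≤ Nat.log 2 k := Nat.cast_nonneg _
      push_cast
      nlinarith
    have hnk' : (n : ℝ) ≤ 4 * k := by exact_mod_cast hnk
    have hkn' : (k : ℝ) ≤ n := by exact_mod_cast hkn
    have h16 : (4 : ℝ) ^ (559 / 419 : ℝ) ≤ 16 := by
      calc (4 : ℝ) ^ (559 / 419 : ℝ) ≤ (4 : ℝ) ^ (2 : ℝ) :=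
            Real.rpow_le_rpow_of_exponent_le (by norm_num) (by norm_num)
        _ = 16 := by norm_num
    have hceil : ((m + ⌈(k : ℝ) ^ (4 / 3 : ℝ)⌉₊ : ℕ) : ℝ) ≤ m + 2 * (n : ℝ) ^ (4 / 3 : ℝ) := by
      have h1 := Nat.ceil_lt_add_one (a := (k : ℝ) ^ (4 / 3 : ℝ)) (by positivity)
      have h2 : (k : ℝ) ^ (4 / 3 : ℝ) ≤ (n : ℝ) ^ (4 / 3 : ℝ) := by gcongr
      have h3 : (1 : ℝ) ≤ (n : ℝ) ^ (4 / 3 : ℝ) := Real.one_le_rpow (by linarith) (by norm_num)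
      push_cast
      linarith
    have h1 : (n : ℝ) ^ (559 / 419 : ℝ) ≤
        48 * K * Real.log n * m + 96 * K * Real.log n * (n : ℝ) ^ (4 / 3 : ℝ) := by
      calc (n : ℝ) ^ (559 / 419 : ℝ) ≤ (4 * k : ℝ) ^ (559 / 419 : ℝ) := by gcongr
        _ = (4 : ℝ) ^ (559 / 419 : ℝ) * (k : ℝ) ^ (559 / 419 : ℝ) :=
            Real.mul_rpow (by norm_num) (by positivity)
        _ ≤ 16 * (K * (3 * Real.log n) * (m + 2 * (n : ℝ) ^ (4 / 3 : ℝ))) := by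
            gcongr
            exact h.trans (by gcongr)
        _ = _ := by ring
    have h2 : 96 * K * Real.log n * (n : ℝ) ^ (4 / 3 : ℝ) ≤ 1 / 2 * (n : ℝ) ^ (559 / 419 : ℝ) := by
      have h3 := hN n hnN
      rw [Real.norm_of_nonneg hlogpos.le, Real.norm_of_nonneg (by positivity)] at h3
      have h4 : (n : ℝ) ^ (559 / 419 : ℝ) = (n : ℝ) ^ (1 / 1257 : ℝ) * (n : ℝ) ^ (4 / 3 : ℝ) := by
        rw [← Real.rpow_add (by linarith)]
        norm_num
      calc 96 * K * Real.log n * (n : ℝ) ^ (4 / 3 : ℝ)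
          ≤ 96 * K * (1 / (192 * K) * (n : ℝ) ^ (1 / 1257 : ℝ)) * (n : ℝ) ^ (4 / 3 : ℝ) := by gcongr
        _ = 1 / 2 * ((n : ℝ) ^ (1 / 1257 : ℝ) * (n : ℝ) ^ (4 / 3 : ℝ)) := by
            field_simp
            norm_num
        _ = _ := by rw [h4]
    calc (n : ℝ) ^ ((4 / 3 : ℝ) + 5 / 9813) ≤ (n : ℝ) ^ (559 / 419 : ℝ) :=
          Real.rpow_le_rpow_of_exponent_le (by linarith) (by norm_num)
      _ ≤ 96 * K * m * Real.log n + 0 := by linarith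
      _ ≤ 96 * K * m * Real.log n + 2 * (N : ℝ) ^ 2 * m * Real.log n := by gcongr; positivity
      _ = _ := by ring

theorem theorem3 :
    (∃ C : ℝ, 0 < C ∧ ∃ κ : ℝ, 0 < κ ∧ ∀ A : Finset ℝ, 2 ≤ A.card →
      (A.card : ℝ) ^ ((4 / 3 : ℝ) + 5 / 9813) ≤
        C * ((max (A + A).card (A * A).card : ℕ) : ℝ) * Real.log (A.card : ℝ) ^ κ) ∧
    (∃ C : ℝ, 0 < C ∧ ∃ κ : ℝ, 0 < κ ∧ ∀ A : Finset ℝ, 2 ≤ A.card →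
      (A.card : ℝ) ^ ((4 / 3 : ℝ) + 5 / 9813) ≤
        C * ((max (A + A).card (quotientSet A A).card : ℕ) : ℝ) *
          Real.log (A.card : ℝ) ^ κ) := by
  obtain ⟨C, hC, hmain⟩ := exists_const_of_rpow_le one_le_sumProductConst
  have hone : ∀ A : Finset ℝ, 2 ≤ A.card → ∀ k, 1 ≤ max (A + A).card k := fun A hA k =>
    le_max_of_le_left (Finset.card_pos.2
      ((Finset.card_pos.1 (by omega : 0 < A.card)).add (Finset.card_pos.1 (by omega : 0 < A.card))))
  refine ⟨⟨C, hC, 1, one_pos, fun A hA => ?_⟩, ⟨C, hC, 1, one_pos, fun A hA => ?_⟩⟩ <;>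
    obtain ⟨P, hP, hne, h4, hPA, hadd, hmul, hdiv⟩ := exists_positive_part A hA
  · refine hmain A.card P.card _ hA h4 hPA (hone A hA _) ?_
    refine (rpow_card_le hP hne (H := P * P) ?_ (controlsRays_mul hP) ?_).trans ?_
    · intro q hq
      obtain ⟨x, hx, y, hy, rfl⟩ := Finset.mem_mul.1 hq
      exact mul_pos (hP x hx) (hP y hy)
    · obtain ⟨x, hx⟩ := hne
      apply Finset.card_le_card_of_injOn (fun y => x * y)
      · intro y hy
        exact Finset.mul_mem_mul hx hy
      · intro y _ z _ h
        exact mul_left_cancel₀ (hP x hx).ne' h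
    · have := one_le_sumProductConst
      gcongr
  · refine hmain A.card P.card _ hA h4 hPA (hone A hA _) ?_
    refine (rpow_card_le hP hne (H := P / P) ?_ (controlsRays_div hP) ?_).trans ?_
    · intro q hq
      obtain ⟨x, hx, y, hy, rfl⟩ := Finset.mem_div.1 hq
      exact div_pos (hP x hx) (hP y hy)
    · obtain ⟨x, hx⟩ := hne
      apply Finset.card_le_card_of_injOn (fun y => y / x)
      · intro y hy
        exact Finset.div_mem_div hy hx
      · intro y _ z _ h
        exact (div_left_inj' (hP x hx).ne').1 h
    · have := one_le_sumProductConst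
      gcongr
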